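/- **Setting.** Let $L\ge 1$ generative models be given. The $\ell$-th model, $\ell\in[L]:=\{1,\dots,L\}$, has a power spectral density (PSD) $s^{(\ell)}:[0,1)\to[0,\infty)$ which is continuous and satisfies $\int_0^1 s^{(\ell)}(f)\,df=1$, and whose autocorrelation function $r^{(\ell)}[m]:=\int_0^1 s^{(\ell)}(f)e^{\mathrm i2\pi fm}\,df$ satisfies $\sum_{m\in\mathbb Z}|r^{(\ell)}[m]|<\infty$. Fix a sampling probability $p\in(0,1]$, a noise variance $\sigma^2\ge 0$ and an observation length $M\ge 1$. A realization of the observed process of model $\ell$ is $\check X[m]=U[m]\,(X[m]+W[m])$, $m\in\mathbb Z$, where the processes $U$, $X$, $W$ are mutually independent, $U$ is i.i.d. with $\mathrm P[U[m]=1]=1-\mathrm P[U[m]=0]=p$, $X$ is a real zero-mean stationary Gaussian process with PSD $s^{(\ell)}$ (i.e. $\mathbb E\,X[n+m]X[n]=r^{(\ell)}[m]$), and $W$ is zero-mean white Gaussian noise with variance $\sigma^2$. The data set consists of $N=\sum_{\ell\in[L]} n_\ell$ observations $\hat x^{(\ell)}_i$, $\ell\in[L]$, $i\in[n_\ell]$,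 each $\hat x^{(\ell)}_i=(\hat x^{(\ell)}_i[0],\dots,\hat x^{(\ell)}_i[M-1])$ being $M$ consecutive entries of a realization of the observed process of model $\ell$. The realizations used for different observations may be identical, independent, or dependent in any way; no independence between observations is assumed, neither within a model nor across models. Let $g:\mathbb Z\to\mathbb R$ be an even window function with $g[0]=1$, $g[m]=0$ for $|m|\ge M$, and $0\le \sum_m g[m]e^{-\mathrm i2\pi fm}\le A<\infty$ for all $f\in[0,1)$. Put $u[0]=p$, $u[m]=p^2$ for $m\neq0$, and $\hat g[m]=g[m]/u[m]$. For an observation $x=(x[0],\dots,x[M-1])$ put $$\hat r_x[m]=\frac1M\sum_{n=0}^{M-|m|-1}x[n+|m|]\,x[n],\qquad \hat s_x(f)=\sum_{m=-M+1}^{M-1}\hat g[m]\,\hat r_x[m]\,e^{-\mathrm i2\pi fm},$$ and define the estimated distance of two observations and the distance of two models by $$d(x,y)=\frac12\int_0^1|\hat s_x(f)-\hat s_y(f)|\,df,\qquad d(X^{(k)},X^{(\ell)})=\frac12\int_0^1|s^{(k)}(f)-s^{(\ell)}(f)|\,df .$$ Let $B=\max_{\ell\in[L]}\sup_{f\in[0,1)}s^{(\ell)}(f)$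 and $\mu_{\max}=\max_{\ell\in[L]}\sum_{m\in\mathbb Z}|h[m]|\,|r^{(\ell)}[m]|$, where $h[m]=1-g[m](1-|m|/M)$ for $|m|<M$ and $h[m]=1$ otherwise. **Theorem 3.** If the clustering condition $$\min_{k\ne \ell} d(X^{(k)},X^{(\ell)})>\frac{8\sqrt2\,A\,\bigl(B+\sigma^2+\sqrt2\,(1+p)(1+\sigma^2)\bigr)}{p^2}\sqrt{\frac{\log M}{M}}+2\mu_{\max}$$ holds, then, with probability at least $1-6N/M^2$, $$\min_{\substack{k,\ell\in[L]\\ k\neq \ell}}\ \min_{i\in[n_\ell],\,j\in[n_k]} d(\hat x^{(k)}_j,\hat x^{(\ell)}_i)\;>\;\max_{\ell\in[L]}\ \max_{\substack{i,j\in[n_\ell]\\ i\neq j}} d(\hat x^{(\ell)}_i,\hat x^{(\ell)}_j),$$ that is, every estimated distance between observations from different models exceeds every estimated distance between distinct observations from the same model (minima and maxima over empty index sets impose no restriction). -/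

import Mathlib

open MeasureTheory ProbabilityTheory

noncomputable section

namespace ProcessClustering

/-- The autocorrelation function `r[m] = ∫₀¹ s(f) e^{i 2π f m} df` belonging to a power spectral
density `s`. (It is real-valued as soon as it is the autocorrelation of a real process.) -/
def acf (s : ℝ → ℝ) (m : ℤ) : ℂ :=
  ∫ f in (0 : ℝ)..1, (s f : ℂ) * Complex.exp (Complex.I * (2 * Real.pi * f * m : ℝ))

/-- The admissible power spectral densities on `[0, 1)`: non-negative, continuous, integrable,
normalized to unit power, with absolutely summable autocorrelation function. -/
structure IsNormalizedPSD (s : ℝ → ℝ) : Prop where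
  nonneg : ∀ f ∈ Set.Ico (0 : ℝ) 1, 0 ≤ s f
  continuousOn : ContinuousOn s (Set.Ico (0 : ℝ) 1)
  integrableOn : IntegrableOn s (Set.Ico (0 : ℝ) 1)
  integral_eq_one : ∫ f in (0 : ℝ)..1, s f = 1
  summable_acf : Summable fun m : ℤ => ‖acf s m‖

/-- The distance `d(X⁽ᵏ⁾, X⁽ˡ⁾) = (1/2) ∫₀¹ |s_k(f) - s_l(f)| df` between two processes with power
spectral densities `s` and `s'`. -/
def psdDist (s s' : ℝ → ℝ) : ℝ :=
  (1 / 2) * ∫ f in (0 : ℝ)..1, |s f - s' f|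

/-- The discrete-time Fourier transform `g(f) = ∑ₘ g[m] e^{-i 2π f m}`. -/
def dtft (g : ℤ → ℝ) (f : ℝ) : ℂ :=
  ∑' m : ℤ, (g m : ℂ) * Complex.exp (-(Complex.I * (2 * Real.pi * f * m : ℝ)))

/-- The admissible window functions for observation length `M`: even, vanishing for `|m| ≥ M`,
with `g[0] = 1` and `0 ≤ g(f) ≤ A` on `[0, 1)`. (The transform of an even real sequence is
real-valued, so taking real parts loses nothing.) -/
structure IsWindow (M : ℕ) (A : ℝ) (g : ℤ → ℝ) : Prop where
  even : ∀ m, g (-m) = g m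
  support : ∀ m : ℤ, (M : ℤ) ≤ |m| → g m = 0
  at_zero : g 0 = 1
  dtft_nonneg : ∀ f ∈ Set.Ico (0 : ℝ) 1, 0 ≤ (dtft g f).re
  dtft_le : ∀ f ∈ Set.Ico (0 : ℝ) 1, (dtft g f).re ≤ A

/-- The sampling weight: `u[0] = p`, and `u[m] = p²` for `m ≠ 0`. -/
def samplingWeight (p : ℝ) (m : ℤ) : ℝ := if m = 0 then p else p ^ 2

/-- The bias-corrected window `ĝ[m] = g[m] / u[m]`. -/
def correctedWindow (g : ℤ → ℝ) (p : ℝ) (m : ℤ) : ℝ := g m / samplingWeight p m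

/-- The empirical autocorrelation `r̂[m] = (1/M) ∑_{n=0}^{M-|m|-1} x[n+|m|] x[n]` of the length-`M`
observation `x[0], …, x[M-1]`; only used for `|m| ≤ M - 1`. -/
def empiricalAcf (M : ℕ) (x : ℕ → ℝ) (m : ℤ) : ℝ :=
  (1 / (M : ℝ)) * ∑ n ∈ Finset.range (M - m.natAbs), x (n + m.natAbs) * x n

/-- The Blackman-Tukey estimate `ŝ(f) = ∑_{m=-M+1}^{M-1} ĝ[m] r̂[m] e^{-i 2π f m}`, for a given
window `w` (in the role of `ĝ`). -/
def btEstimate (M : ℕ) (w : ℤ → ℝ) (x : ℕ → ℝ) (f : ℝ) : ℂ :=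
  ∑ m ∈ Finset.Ioo (-(M : ℤ)) (M : ℤ),
    ((w m * empiricalAcf M x m : ℝ) : ℂ) * Complex.exp (-(Complex.I * (2 * Real.pi * f * m : ℝ)))

/-- The estimated distance `d(x, y) = (1/2) ∫₀¹ |ŝ_x(f) - ŝ_y(f)| df` between two length-`M`
observations, with window `w`. -/
def obsDist (M : ℕ) (w : ℤ → ℝ) (x y : ℕ → ℝ) : ℝ :=
  (1 / 2) * ∫ f in (0 : ℝ)..1, ‖btEstimate M w x f - btEstimate M w y f‖

/-- `B = max_ℓ sup_{f ∈ [0,1)} s_ℓ(f)`. -/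
def psdBound {L : ℕ} (s : Fin L → ℝ → ℝ) : ℝ :=
  ⨆ l : Fin L, ⨆ f : Set.Ico (0 : ℝ) 1, s l f

/-- `h[m] = 1 - g[m] (1 - |m|/M)` for `|m| < M`, and `h[m] = 1` otherwise. -/
def momentWeight (M : ℕ) (g : ℤ → ℝ) (m : ℤ) : ℝ :=
  if |m| < (M : ℤ) then 1 - g m * (1 - (|m| : ℤ) / (M : ℝ)) else 1

/-- The autocorrelation moment `μ = ∑ₘ |h[m]| |r[m]|` of a process with PSD `s`. -/
def acfMoment (M : ℕ) (g : ℤ → ℝ) (s : ℝ → ℝ) : ℝ :=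
  ∑' m : ℤ, |momentWeight M g m| * ‖acf s m‖

/-- `μ_max = max_ℓ μ⁽ˡ⁾`. -/
def maxAcfMoment {L : ℕ} (M : ℕ) (g : ℤ → ℝ) (s : Fin L → ℝ → ℝ) : ℝ :=
  ⨆ l : Fin L, acfMoment M g (s l)

variable {Ω : Type*} [MeasurableSpace Ω]

/-- `U` is a Bernoulli process: i.i.d. with `P[U[m] = 1] = 1 - P[U[m] = 0] = p`. -/
structure IsBernoulliProcess (P : Measure Ω) (p : ℝ) (U : ℤ → Ω → ℝ) : Prop where
  measurable : ∀ m, Measurable (U m)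
  indep : iIndepFun U P
  prob_one : ∀ m, P.real {ω | U m ω = 1} = p
  prob_zero : ∀ m, P.real {ω | U m ω = 0} = 1 - p

/-- `X` is a real zero-mean stationary Gaussian process with power spectral density `s`, i.e.
its autocorrelation function `E[X[n+m] X[n]]` depends on `m` only and is `∫₀¹ s(f) e^{i2πfm} df`. -/
structure IsGaussianWithPSD (P : Measure Ω) (s : ℝ → ℝ) (X : ℤ → Ω → ℝ) : Prop where
  measurable : ∀ m, Measurable (X m)
  gaussian : IsGaussianProcess X P
  mean_zero : ∀ m, ∫ ω, X m ω ∂P = 0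
  autocorrelation : ∀ n m, ((∫ ω, X (n + m) ω * X n ω ∂P : ℝ) : ℂ) = acf s m

/-- `W` is zero-mean white Gaussian noise with variance `σ²` (with `σ = 0` allowed). -/
structure IsWhiteGaussianNoise (P : Measure Ω) (σ : NNReal) (W : ℤ → Ω → ℝ) : Prop where
  measurable : ∀ m, Measurable (W m)
  indep : iIndepFun W P
  law : ∀ m, HasLaw (W m) (gaussianReal 0 (σ ^ 2)) P

/-- One realization of the observed process of a generative model: a Bernoulli sampling process
`U`, a Gaussian process `X` with PSD `s` and a white noise `W`, mutually independent. -/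
structure IsRealization (P : Measure Ω) (p : ℝ) (σ : NNReal) (s : ℝ → ℝ)
    (U X W : ℤ → Ω → ℝ) : Prop where
  sampling : IsBernoulliProcess P p U
  signal : IsGaussianWithPSD P s X
  noise : IsWhiteGaussianNoise P σ W
  indep : iIndepFun ![fun ω m => U m ω, fun ω m => X m ω, fun ω m => W m ω] P

/-- The contiguous segment starting at time `t` of the noisy process with missing entries
`X̌[m] = U[m] (X[m] + W[m])`. -/
def observation (U X W : ℤ → Ω → ℝ) (t : ℤ) (ω : Ω) (n : ℕ) : ℝ :=
  U (t + n) ω * (X (t + n) ω + W (t + n) ω)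

end ProcessClustering

end

/-!
Why the clustering condition separates the models with high probability.

**Reduction.** Every spectral estimate `ŝ` of an observation of model `ℓ` is compared with its
expectation `E_ℓ(f) = ∑_{|m|<M} g[m] (1 - |m|/M) (r[m] + σ² δ[m]) e^{-i2πfm}` (`meanEstimate`).
If `∫ |ŝ - E_ℓ| ≤ T` for all observations, the triangle inequality bounds the distance of two
observations of one model by `T` (`obsDist_le`). The bias `E_ℓ - s_ℓ` equals `σ²` up to
`μ_max` (`norm_meanEstimate_sub_le`, from Fourier inversion of the PSD), and the noise floor `σ²`
is the same for all models, so that the distance of two observations of different models is at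
least `d(X⁽ᵏ⁾, X⁽ˡ⁾) - T - μ_max` (`psdDist_le`). The clustering condition says
`2 T + 2 μ_max < d(X⁽ᵏ⁾, X⁽ˡ⁾)` for the value of `T` below.

**From `ŝ` to autocorrelations.** By Parseval and `∑ g[m]² = ∫ g(f)² df ≤ A`, deviations of at most
`ε` of all empirical autocorrelations from their means give `∫ |ŝ - E_ℓ| ≤ A ε / p²`
(`integral_norm_btEstimate_sub_le`). It remains to control `M` lags for each observation and to
take a union bound, which needs no independence between observations.

**One lag.** Given the sampling process, `∑ₙ x[n] x[n+m]` is a quadratic form of a Gaussian vector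
whose covariance matrix has norm at most `B + σ²`, because the form of a Toeplitz matrix is bounded
by the supremum of its symbol (`sum_mul_acf_le`). In an eigenbasis it is a weighted sum of squares
of independent Gaussians, and
Chernoff's bound applies (`measure_abs_quadForm_sub_ge_le`). The conditional mean is a multiple of
`∑ₙ U[n] U[n+m]`, which splits into a martingale and a sum of independent variables, both
sub-Gaussian (`IsBernoulliProcess.measure_lag_sum_sub_ge_le`). Together the deviations of order
`√(log M / M)` have probability at most `6 / M⁴` per lag, provided that `log M / M` is small. That
proviso is implied by the clustering condition, because two normalized PSDs have distance at
most `1`.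
-/

namespace ProcessClustering

/-! ### Exponentials and absolutely convergent Fourier series on the unit interval -/

/-- The exponential `f ↦ e^{i 2π f m}` of integer frequency `m`. -/
noncomputable def expo (m : ℤ) (f : ℝ) : ℂ :=
  Complex.exp (Complex.I * (2 * Real.pi * f * m : ℝ))

lemma exp_neg_eq_expo (m : ℤ) (f : ℝ) :
    Complex.exp (-(Complex.I * (2 * Real.pi * f * m : ℝ))) = expo (-m) f := by
  rw [expo]; congr 1; push_cast; ring

lemma continuous_expo (m : ℤ) : Continuous (expo m) := by
  unfold expo; fun_prop

lemma norm_expo (m : ℤ) (f : ℝ) : ‖expo m f‖ = 1 := by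
  rw [expo, mul_comm]; exact Complex.norm_exp_ofReal_mul_I _

lemma expo_zero (f : ℝ) : expo 0 f = 1 := by simp [expo]

lemma expo_add (m n : ℤ) (f : ℝ) : expo (m + n) f = expo m f * expo n f := by
  rw [expo, expo, expo, ← Complex.exp_add]; congr 1; push_cast; ring

lemma conj_expo (m : ℤ) (f : ℝ) : (starRingEnd ℂ) (expo m f) = expo (-m) f := by
  rw [expo, expo, ← Complex.exp_conj, map_mul, Complex.conj_I, Complex.conj_ofReal]
  congr 1; push_cast; ring

lemma fourier_eq_expo (m : ℤ) (f : ℝ) : fourier m (f : AddCircle (1 : ℝ)) = expo m f := by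
  rw [fourier_coe_apply, expo]; congr 1; push_cast; ring

lemma integral_expo (m : ℤ) : ∫ f in (0 : ℝ)..1, expo m f = if m = 0 then 1 else 0 := by
  split_ifs with h
  · subst h; simp [expo_zero]
  · have hc : (2 * Real.pi * m * Complex.I : ℂ) ≠ 0 := by
      simp [Real.pi_ne_zero, h]
    have : ∀ f : ℝ, expo m f = Complex.exp ((2 * Real.pi * m * Complex.I : ℂ) * f) := by
      intro f; rw [expo]; congr 1; push_cast; ring
    simp_rw [this]
    rw [integral_exp_mul_complex hc]
    have h1 : Complex.exp ((2 * Real.pi * m * Complex.I : ℂ) * (1 : ℝ)) = 1 := by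
      rw [Complex.exp_eq_one_iff]; exact ⟨m, by push_cast; ring⟩
    rw [h1]; simp

/-- An integrable function on the unit interval is determined by its Fourier coefficients:
trigonometric polynomials are uniformly dense among the continuous periodic functions, hence the
function integrates to zero against every test function supported in `(0, 1)`. -/
lemma ae_eq_zero_of_integral_mul_expo_eq_zero {F : ℝ → ℂ} (hF : IntegrableOn F (Set.Ioc 0 1))
    (h0 : ∀ m, ∫ f in Set.Ioc (0 : ℝ) 1, F f * expo m f = 0) :
    ∀ᵐ f ∂volume.restrict (Set.Ioc (0 : ℝ) 1), F f = 0 := by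
  have : Fact ((0 : ℝ) < 1) := ⟨one_pos⟩
  have hint (φ : C(AddCircle (1 : ℝ), ℂ)) :
      IntegrableOn (fun f : ℝ => F f * φ (f : AddCircle (1 : ℝ))) (Set.Ioc 0 1) := by
    refine hF.mul_bdd (c := ‖φ‖) ?_ (Filter.Eventually.of_forall fun f => φ.norm_coe_le_norm _)
    exact (φ.continuous.comp (AddCircle.continuous_mk' 1)).aestronglyMeasurable
  let Λ₀ : C(AddCircle (1 : ℝ), ℂ) →ₗ[ℂ] ℂ :=
    { toFun := fun φ => ∫ f in Set.Ioc (0 : ℝ) 1, F f * φ (f : AddCircle (1 : ℝ))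
      map_add' := fun φ ψ => by
        rw [← integral_add (hint φ) (hint ψ)]
        refine integral_congr_ae (Filter.Eventually.of_forall fun f => ?_)
        simp [mul_add]
      map_smul' := fun c φ => by
        rw [RingHom.id_apply, smul_eq_mul, ← integral_const_mul]
        refine integral_congr_ae (Filter.Eventually.of_forall fun f => ?_)
        simp; ring }
  let Λ : C(AddCircle (1 : ℝ), ℂ) →L[ℂ] ℂ := Λ₀.mkContinuous
    (∫ f in Set.Ioc (0 : ℝ) 1, ‖F f‖) fun φ => by
      change ‖∫ f in Set.Ioc (0 : ℝ) 1, F f * φ (f : AddCircle (1 : ℝ))‖ ≤ _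
      refine (norm_integral_le_integral_norm _).trans ?_
      rw [← integral_mul_const]
      refine integral_mono_of_nonneg (Filter.Eventually.of_forall fun _ => norm_nonneg _)
        (hF.norm.mul_const _) (Filter.Eventually.of_forall fun f => ?_)
      simp only [norm_mul]
      gcongr
      exact φ.norm_coe_le_norm _
  have hker : (⊤ : Submodule ℂ C(AddCircle (1 : ℝ), ℂ)) ≤ LinearMap.ker Λ.toLinearMap := by
    rw [← span_fourier_closure_eq_top]
    refine Submodule.topologicalClosure_minimal _ ?_ Λ.isClosed_ker
    rw [Submodule.span_le]
    rintro _ ⟨m, rfl⟩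
    change ∫ f in Set.Ioc (0 : ℝ) 1, F f * fourier m (f : AddCircle (1 : ℝ)) = 0
    simp_rw [fourier_eq_expo]
    exact h0 m
  have hΛ (φ : C(AddCircle (1 : ℝ), ℂ)) :
      ∫ f in Set.Ioc (0 : ℝ) 1, F f * φ (f : AddCircle (1 : ℝ)) = 0 :=
    hker (Submodule.mem_top : φ ∈ ⊤)
  have key : ∀ᵐ f ∂(volume : Measure ℝ), f ∈ Set.Ioo (0 : ℝ) 1 → F f = 0 := by
    refine isOpen_Ioo.ae_eq_zero_of_integral_contDiff_smul_eq_zero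
      ((hF.mono_set Set.Ioo_subset_Ioc_self).locallyIntegrableOn) ?_
    intro g hg _ hsupp
    have hz (x : ℝ) (hx : x ∉ Set.Ioo (0 : ℝ) 1) : g x = 0 :=
      image_eq_zero_of_notMem_tsupport fun h => hx (hsupp h)
    have hcont : Continuous (AddCircle.liftIco (1 : ℝ) 0 fun x => (g x : ℂ)) := by
      refine AddCircle.liftIco_continuous ?_ ?_
      · rw [hz 0 (by simp), hz (0 + 1) (by simp)]
      · exact (Complex.continuous_ofReal.comp hg.continuous).continuousOn
    rw [← hΛ ⟨_, hcont⟩, integral_Ioc_eq_integral_Ioo, ← integral_indicator measurableSet_Ioo]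
    refine integral_congr_ae (Filter.Eventually.of_forall fun x => ?_)
    by_cases hx : x ∈ Set.Ioo (0 : ℝ) 1
    · have := AddCircle.liftIco_coe_apply (p := (1 : ℝ)) (a := 0) (f := fun x => (g x : ℂ))
        (x := x) (by rw [zero_add]; exact ⟨hx.1.le, hx.2⟩)
      simp only [Set.indicator_of_mem hx, ContinuousMap.coe_mk]
      rw [this, Complex.real_smul, mul_comm]
    · simp [Set.indicator_of_notMem hx, hz x hx]
  rw [← restrict_Ioo_eq_restrict_Ioc, ae_restrict_iff' measurableSet_Ioo]
  exact key

/-- The Fourier series of a sequence `r`, in the sign convention that inverts `acf`. -/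
noncomputable def fourierSeries (r : ℤ → ℂ) (f : ℝ) : ℂ := ∑' m : ℤ, r m * expo (-m) f

lemma continuous_fourierSeries {r : ℤ → ℂ} (hr : Summable fun m => ‖r m‖) :
    Continuous (fourierSeries r) :=
  continuous_tsum (fun m => (continuous_expo (-m)).const_mul _) hr
    fun m f => by rw [norm_mul, norm_expo, mul_one]

lemma integral_fourierSeries_mul_expo {r : ℤ → ℂ} (hr : Summable fun m => ‖r m‖) (m : ℤ) :
    ∫ f in Set.Ioc (0 : ℝ) 1, fourierSeries r f * expo m f = r m := by
  have hterm (k : ℤ) : ∫ f in Set.Ioc (0 : ℝ) 1, r k * expo (m - k) f =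
      if k = m then r m else 0 := by
    rw [← intervalIntegral.integral_of_le zero_le_one, intervalIntegral.integral_const_mul,
      integral_expo]
    by_cases h : k = m
    · simp [h]
    · rw [if_neg h, if_neg (by omega), mul_zero]
  have hnorm (k : ℤ) : ∫ f in Set.Ioc (0 : ℝ) 1, ‖r k * expo (m - k) f‖ = ‖r k‖ := by
    simp [norm_expo]
  have h := hasSum_integral_of_summable_integral_norm
    (F := fun (k : ℤ) (f : ℝ) => r k * expo (m - k) f) (μ := volume.restrict (Set.Ioc (0 : ℝ) 1))
    (fun k => ((continuous_expo _).const_mul _).integrableOn_Ioc) (by simpa only [hnorm] using hr)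
  simp only [hterm] at h
  rw [← h.unique (hasSum_ite_eq m (r m))]
  refine integral_congr_ae (Filter.Eventually.of_forall fun f => ?_)
  simp only [fourierSeries]
  rw [← tsum_mul_right]
  refine tsum_congr fun k => ?_
  rw [mul_assoc, ← expo_add]; congr 2; ring

lemma acf_eq (s : ℝ → ℝ) (m : ℤ) :
    acf s m = ∫ f in Set.Ioc (0 : ℝ) 1, (s f : ℂ) * expo m f := by
  rw [acf, intervalIntegral.integral_of_le zero_le_one]; rfl

lemma IsNormalizedPSD.integrableOn_ofReal {s : ℝ → ℝ} (hs : IsNormalizedPSD s) :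
    IntegrableOn (fun f => (s f : ℂ)) (Set.Ioc 0 1) := by
  have h : IntegrableOn s (Set.Ioc 0 1) := by
    simpa only [IntegrableOn, restrict_Ico_eq_restrict_Ioc] using hs.integrableOn
  exact h.ofReal

/-- Fourier inversion: a power spectral density is the Fourier series of its autocorrelation
function, at every point of `[0, 1)`. -/
lemma IsNormalizedPSD.eq_fourierSeries {s : ℝ → ℝ} (hs : IsNormalizedPSD s) {f : ℝ}
    (hf : f ∈ Set.Ico (0 : ℝ) 1) : (s f : ℂ) = fourierSeries (acf s) f := by
  have hcont := continuous_fourierSeries hs.summable_acf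
  have hint := hs.integrableOn_ofReal
  have hae := ae_eq_zero_of_integral_mul_expo_eq_zero
    (F := fun f => (s f : ℂ) - fourierSeries (acf s) f) (hint.sub hcont.integrableOn_Ioc) ?_
  · rw [← restrict_Ico_eq_restrict_Ioc] at hae
    exact Measure.eqOn_Ico_of_ae_eq (μ := volume) (f := fun f => (s f : ℂ))
      (hae.mono fun f h => sub_eq_zero.mp h)
      (Complex.continuous_ofReal.comp_continuousOn hs.continuousOn) hcont.continuousOn hf
  · intro m
    simp_rw [sub_mul]
    rw [integral_sub, ← acf_eq, integral_fourierSeries_mul_expo hs.summable_acf, sub_self]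
    · refine hint.mul_bdd (c := 1) (continuous_expo m).aestronglyMeasurable
        (Filter.Eventually.of_forall fun f => (norm_expo m f).le)
    · exact (hcont.mul (continuous_expo m)).integrableOn_Ioc

lemma IsNormalizedPSD.le_tsum {s : ℝ → ℝ} (hs : IsNormalizedPSD s) {f : ℝ}
    (hf : f ∈ Set.Ico (0 : ℝ) 1) : s f ≤ ∑' m, ‖acf s m‖ := by
  calc s f ≤ ‖(s f : ℂ)‖ := by rw [Complex.norm_real]; exact Real.le_norm_self _
    _ = ‖∑' m : ℤ, acf s m * expo (-m) f‖ := by rw [hs.eq_fourierSeries hf]; rfl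
    _ ≤ ∑' m, ‖acf s m * expo (-m) f‖ := norm_tsum_le_tsum_norm <| by
        simpa [norm_mul, norm_expo] using hs.summable_acf
    _ = _ := by simp [norm_expo]

/-- `psdBound` is a genuine upper bound: continuity on `[0, 1)` alone would leave room for a PSD
that is unbounded near `1`, but the Fourier series excludes this. -/
lemma le_psdBound {L : ℕ} {s : Fin L → ℝ → ℝ} (hs : ∀ l, IsNormalizedPSD (s l)) (l : Fin L)
    {f : ℝ} (hf : f ∈ Set.Ico (0 : ℝ) 1) : s l f ≤ psdBound s := by
  have h1 : s l f ≤ ⨆ f : Set.Ico (0 : ℝ) 1, s l f :=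
    le_ciSup (f := fun f : Set.Ico (0 : ℝ) 1 => s l f)
      ⟨∑' m, ‖acf (s l) m‖, by rintro _ ⟨x, rfl⟩; exact (hs l).le_tsum x.2⟩ ⟨f, hf⟩
  exact h1.trans (le_ciSup (f := fun l => ⨆ f : Set.Ico (0 : ℝ) 1, s l f)
    (Set.finite_range _).bddAbove l)

/-! ### Trigonometric polynomials -/

section

variable {ι : Type*} [Fintype ι]

lemma sq_norm_trigSum (a : ι → ℂ) (k : ι → ℤ) (f : ℝ) :
    ((‖∑ i, a i * expo (k i) f‖ ^ 2 : ℝ) : ℂ) =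
      ∑ i, ∑ j, a i * (starRingEnd ℂ) (a j) * expo (k i - k j) f := by
  rw [Complex.ofReal_pow, ← Complex.mul_conj', map_sum, Finset.sum_mul_sum]
  refine Finset.sum_congr rfl fun i _ => Finset.sum_congr rfl fun j _ => ?_
  rw [map_mul, conj_expo, sub_eq_add_neg, expo_add]; ring

lemma continuous_trigSum (a : ι → ℂ) (k : ι → ℤ) :
    Continuous fun f => ∑ i, a i * expo (k i) f :=
  continuous_finsetSum _ fun _ _ => (continuous_expo _).const_mul _

/-- Parseval's identity for trigonometric polynomials. -/
lemma integral_sq_norm_trigSum (a : ι → ℂ) {k : ι → ℤ} (hk : Function.Injective k) :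
    ∫ f in (0 : ℝ)..1, ‖∑ i, a i * expo (k i) f‖ ^ 2 = ∑ i, ‖a i‖ ^ 2 := by
  classical
  apply Complex.ofReal_injective
  rw [← intervalIntegral.integral_ofReal]
  simp_rw [sq_norm_trigSum]
  rw [intervalIntegral.integral_finsetSum fun i _ => (continuous_finsetSum _ fun j _ =>
    (continuous_expo _).const_mul _).intervalIntegrable _ _, Complex.ofReal_sum]
  refine Finset.sum_congr rfl fun i _ => ?_
  rw [intervalIntegral.integral_finsetSum fun j _ =>
    ((continuous_expo _).const_mul _).intervalIntegrable _ _]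
  simp_rw [intervalIntegral.integral_const_mul, integral_expo, sub_eq_zero, hk.eq_iff]
  simp [Complex.mul_conj']

/-- On the unit interval the mean of the modulus is at most the root mean square. -/
lemma integral_norm_trigSum_le (a : ι → ℂ) {k : ι → ℤ} (hk : Function.Injective k) :
    ∫ f in (0 : ℝ)..1, ‖∑ i, a i * expo (k i) f‖ ≤ √(∑ i, ‖a i‖ ^ 2) := by
  rw [← integral_sq_norm_trigSum a hk]
  set h : ℝ → ℝ := fun f => ‖∑ i, a i * expo (k i) f‖
  have hc : Continuous h := (continuous_trigSum a k).norm
  set c := ∫ f in (0 : ℝ)..1, h f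
  refine Real.le_sqrt_of_sq_le ?_
  have h0 : 0 ≤ ∫ f in (0 : ℝ)..1, (h f - c) ^ 2 :=
    intervalIntegral.integral_nonneg zero_le_one fun f _ => sq_nonneg _
  have h1 : ∫ f in (0 : ℝ)..1, (h f - c) ^ 2 = (∫ f in (0 : ℝ)..1, h f ^ 2) - c ^ 2 := by
    have : ∀ f, (h f - c) ^ 2 = h f ^ 2 - 2 * c * h f + c ^ 2 := fun f => by ring
    simp_rw [this]
    rw [intervalIntegral.integral_add, intervalIntegral.integral_sub,
      intervalIntegral.integral_const_mul]
    · simp only [intervalIntegral.integral_const, sub_zero, one_smul]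
      change _ - 2 * c * c + _ = _
      ring
    all_goals exact Continuous.intervalIntegrable (by fun_prop) _ _
  linarith

/-- The quadratic form of a Toeplitz matrix is bounded by the supremum of its symbol. -/
lemma sum_mul_acf_le {s : ℝ → ℝ} (hs : IsNormalizedPSD s) {B : ℝ}
    (hB : ∀ f ∈ Set.Ico (0 : ℝ) 1, s f ≤ B) (a : ι → ℝ) {k : ι → ℤ}
    (hk : Function.Injective k) :
    ∑ i, ∑ j, a i * a j * (acf s (k i - k j)).re ≤ B * ∑ i, a i ^ 2 := by
  set q : ℝ → ℝ := fun f => ‖∑ i, (a i : ℂ) * expo (k i) f‖ ^ 2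
  have hq : Continuous q := (continuous_trigSum _ k).norm.pow 2
  have hsint := hs.integrableOn_ofReal
  have hterm (m : ℤ) : IntegrableOn (fun f => (s f : ℂ) * expo m f) (Set.Ioc 0 1) :=
    hsint.mul_bdd (c := 1) (continuous_expo m).aestronglyMeasurable
      (Filter.Eventually.of_forall fun f => (norm_expo m f).le)
  have h1 : (∑ i, ∑ j, ((a i * a j : ℝ) : ℂ) * acf s (k i - k j)) =
      ((∫ f in Set.Ico (0 : ℝ) 1, s f * q f : ℝ) : ℂ) := by
    rw [restrict_Ico_eq_restrict_Ioc, ← integral_complex_ofReal]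
    simp_rw [acf_eq, ← integral_const_mul]
    rw [← Finset.sum_congr rfl fun i _ => integral_finsetSum _ fun j _ =>
        (hterm (k i - k j)).const_mul _,
      ← integral_finsetSum _ fun i _ => integrable_finsetSum _ fun j _ =>
        (hterm (k i - k j)).const_mul _]
    refine integral_congr_ae (Filter.Eventually.of_forall fun f => ?_)
    simp only [q]
    rw [Complex.ofReal_mul, sq_norm_trigSum, Finset.mul_sum]
    refine Finset.sum_congr rfl fun i _ => ?_
    rw [Finset.mul_sum]
    refine Finset.sum_congr rfl fun j _ => ?_
    rw [Complex.conj_ofReal, Complex.ofReal_mul]; ring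
  have h2 : ∑ i, ∑ j, a i * a j * (acf s (k i - k j)).re =
      ∫ f in Set.Ico (0 : ℝ) 1, s f * q f := by
    have := congrArg Complex.re h1
    simpa only [Complex.re_sum, Complex.re_ofReal_mul, Complex.ofReal_re] using this
  have h3 : ∫ f in Set.Ico (0 : ℝ) 1, q f = ∑ i, a i ^ 2 := by
    have := integral_sq_norm_trigSum (fun i => (a i : ℂ)) hk
    rw [intervalIntegral.integral_of_le zero_le_one, ← restrict_Ico_eq_restrict_Ioc] at this
    simpa using this
  rw [h2, ← h3, ← integral_const_mul]
  have hqi : IntegrableOn q (Set.Ico 0 1) :=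
    (hq.integrableOn_Icc (a := 0) (b := 1)).mono_set Set.Ico_subset_Icc_self
  refine integral_mono_of_nonneg ?_ (hqi.const_mul B) ?_
  · exact (ae_restrict_iff' measurableSet_Ico).mpr (Filter.Eventually.of_forall fun f hf =>
      mul_nonneg (hs.nonneg f hf) (sq_nonneg _))
  · exact (ae_restrict_iff' measurableSet_Ico).mpr (Filter.Eventually.of_forall fun f hf =>
      mul_le_mul_of_nonneg_right (hB f hf) (sq_nonneg _))

lemma norm_acf_le_one {s : ℝ → ℝ} (hs : IsNormalizedPSD s) (m : ℤ) : ‖acf s m‖ ≤ 1 := by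
  have h := hs.integral_eq_one
  rw [intervalIntegral.integral_of_le zero_le_one, ← restrict_Ico_eq_restrict_Ioc] at h
  rw [acf_eq, ← restrict_Ico_eq_restrict_Ioc]
  refine (norm_integral_le_of_norm_le hs.integrableOn ?_).trans_eq h
  refine (ae_restrict_iff' measurableSet_Ico).mpr (Filter.Eventually.of_forall fun f hf => ?_)
  rw [norm_mul, norm_expo, mul_one, Complex.norm_real, Real.norm_of_nonneg (hs.nonneg f hf)]

/-! ### The window -/

lemma sum_Ioo_eq_sum_attach (S : Finset ℤ) (a : ℤ → ℂ) (f : ℝ) :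
    ∑ m ∈ S, a m * expo (-m) f = ∑ i : S, a i * expo (-(i : ℤ)) f :=
  (Finset.sum_coe_sort S fun m => a m * expo (-m) f).symm

lemma injective_neg_coe (S : Finset ℤ) : Function.Injective fun i : S => -(i : ℤ) :=
  neg_injective.comp Subtype.val_injective

lemma IsWindow.dtft_eq {M : ℕ} {A : ℝ} {g : ℤ → ℝ} (hg : IsWindow M A g) (f : ℝ) :
    dtft g f = ∑ m ∈ Finset.Ioo (-(M : ℤ)) M, (g m : ℂ) * expo (-m) f := by
  unfold dtft
  simp_rw [exp_neg_eq_expo]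
  refine tsum_eq_sum fun m hm => ?_
  rw [hg.support m, Complex.ofReal_zero, zero_mul]
  rw [Finset.mem_Ioo, ← abs_lt] at hm
  exact not_lt.mp hm

lemma IsWindow.dtft_im {M : ℕ} {A : ℝ} {g : ℤ → ℝ} (hg : IsWindow M A g) (f : ℝ) :
    (dtft g f).im = 0 := by
  rw [← Complex.conj_eq_iff_im, dtft, Complex.conj_tsum, ← (Equiv.neg ℤ).tsum_eq]
  refine tsum_congr fun m => ?_
  simp_rw [exp_neg_eq_expo]
  rw [map_mul, Complex.conj_ofReal, conj_expo, Equiv.neg_apply, hg.even]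
  simp

lemma IsWindow.integral_dtft_re {M : ℕ} {A : ℝ} {g : ℤ → ℝ} (hM : 0 < M)
    (hg : IsWindow M A g) : ∫ f in (0 : ℝ)..1, (dtft g f).re = 1 := by
  have h : ∫ f in (0 : ℝ)..1, dtft g f = 1 := by
    simp_rw [hg.dtft_eq]
    rw [intervalIntegral.integral_finsetSum fun m _ =>
      ((continuous_expo _).const_mul _).intervalIntegrable _ _]
    simp_rw [intervalIntegral.integral_const_mul, integral_expo, neg_eq_zero]
    simp [hg.at_zero, hM]
  have h2 : ∀ f, dtft g f = (((dtft g f).re : ℝ) : ℂ) := fun f =>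
    Complex.ext rfl (by simpa using hg.dtft_im f)
  rw [intervalIntegral.integral_congr fun f _ => h2 f, intervalIntegral.integral_ofReal] at h
  exact_mod_cast h

lemma IsWindow.continuous_dtft {M : ℕ} {A : ℝ} {g : ℤ → ℝ} (hg : IsWindow M A g) :
    Continuous (dtft g) := by
  have : dtft g = fun f => ∑ m ∈ Finset.Ioo (-(M : ℤ)) M, (g m : ℂ) * expo (-m) f :=
    funext hg.dtft_eq
  rw [this]
  exact continuous_finsetSum _ fun _ _ => (continuous_expo _).const_mul _

lemma IsWindow.one_le {M : ℕ} {A : ℝ} {g : ℤ → ℝ} (hM : 0 < M) (hg : IsWindow M A g) :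
    1 ≤ A := by
  rw [← hg.integral_dtft_re hM, intervalIntegral.integral_of_le zero_le_one,
    ← restrict_Ico_eq_restrict_Ioc]
  have hA : ∫ _ in Set.Ico (0 : ℝ) 1, A = A := by simp
  rw [← hA]
  have hre := Complex.continuous_re.comp hg.continuous_dtft
  exact setIntegral_mono_on (hre.integrableOn_Icc.mono_set Set.Ico_subset_Icc_self) (by simp)
    measurableSet_Ico hg.dtft_le

/-- The energy of the window is at most `A`: by Parseval it equals `∫ g(f)² df ≤ A ∫ g(f) df`. -/
lemma IsWindow.sum_sq_le {M : ℕ} {A : ℝ} {g : ℤ → ℝ} (hM : 0 < M) (hg : IsWindow M A g) :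
    ∑ m ∈ Finset.Ioo (-(M : ℤ)) M, g m ^ 2 ≤ A := by
  have hP := integral_sq_norm_trigSum
    (fun i : Finset.Ioo (-(M : ℤ)) (M : ℤ) => (g i : ℂ)) (injective_neg_coe _)
  simp_rw [← sum_Ioo_eq_sum_attach _ (fun m => (g m : ℂ)), ← hg.dtft_eq] at hP
  have h1 : ∑ m ∈ Finset.Ioo (-(M : ℤ)) M, g m ^ 2 = ∫ f in (0 : ℝ)..1, ‖dtft g f‖ ^ 2 := by
    rw [hP, ← Finset.sum_coe_sort]
    simp
  have hre : Continuous fun f => (dtft g f).re := Complex.continuous_re.comp hg.continuous_dtft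
  have h2 (f : ℝ) : ‖dtft g f‖ ^ 2 = (dtft g f).re ^ 2 := by
    rw [← Complex.normSq_eq_norm_sq, Complex.normSq_apply, hg.dtft_im]; ring
  rw [h1]
  calc ∫ f in (0 : ℝ)..1, ‖dtft g f‖ ^ 2 ≤ ∫ f in (0 : ℝ)..1, A * (dtft g f).re := by
        simp_rw [h2]
        rw [intervalIntegral.integral_of_le zero_le_one,
          intervalIntegral.integral_of_le zero_le_one, ← restrict_Ico_eq_restrict_Ioc]
        refine setIntegral_mono_on
          ((hre.pow 2).integrableOn_Icc.mono_set Set.Ico_subset_Icc_self)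
          ((hre.const_mul A).integrableOn_Icc.mono_set Set.Ico_subset_Icc_self)
          measurableSet_Ico fun f hf => ?_
        rw [sq]
        exact mul_le_mul_of_nonneg_right (hg.dtft_le f hf) (hg.dtft_nonneg f hf)
    _ = A := by rw [intervalIntegral.integral_const_mul, hg.integral_dtft_re hM, mul_one]

/-! ### The mean of the spectral estimate -/

/-- The autocorrelation function of the noisy process `X + W`. -/
noncomputable def noisyAcf (s : ℝ → ℝ) (σ : NNReal) (m : ℤ) : ℂ :=
  acf s m + if m = 0 then (σ : ℂ) ^ 2 else 0

/-- The expectation `∑_{|m|<M} g[m] (1 - |m|/M) (r[m] + σ² δ[m]) e^{-i 2π f m}` of the spectral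
estimate of a length-`M` observation. -/
noncomputable def meanEstimate (M : ℕ) (g : ℤ → ℝ) (s : ℝ → ℝ) (σ : NNReal) (f : ℝ) : ℂ :=
  ∑ m ∈ Finset.Ioo (-(M : ℤ)) M,
    ((g m * (1 - (|m| : ℤ) / (M : ℝ)) : ℝ) : ℂ) * noisyAcf s σ m * expo (-m) f

lemma continuous_meanEstimate (M : ℕ) (g : ℤ → ℝ) (s : ℝ → ℝ) (σ : NNReal) :
    Continuous (meanEstimate M g s σ) :=
  continuous_finsetSum _ fun _ _ => (continuous_expo _).const_mul _

lemma summable_momentWeight_mul {s : ℝ → ℝ} (hs : IsNormalizedPSD s) (M : ℕ) (g : ℤ → ℝ) :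
    Summable fun m => |momentWeight M g m| * ‖acf s m‖ := by
  refine (summable_congr_cofinite ?_).mpr hs.summable_acf
  refine Set.Finite.subset (Finset.Ioo (-(M : ℤ)) M).finite_toSet fun m hm => ?_
  rw [Finset.mem_coe, Finset.mem_Ioo, ← abs_lt]
  by_contra h
  exact hm (by simp [momentWeight, h])

/-- The bias of the spectral estimate, apart from the constant noise floor `σ²`, is bounded by the
autocorrelation moment. -/
lemma norm_meanEstimate_sub_le {s : ℝ → ℝ} (hs : IsNormalizedPSD s) {M : ℕ} (hM : 0 < M)
    {A : ℝ} {g : ℤ → ℝ} (hg : IsWindow M A g) (σ : NNReal) {f : ℝ}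
    (hf : f ∈ Set.Ico (0 : ℝ) 1) :
    ‖meanEstimate M g s σ f - (s f + (σ : ℝ) ^ 2 : ℝ)‖ ≤ acfMoment M g s := by
  have hsum : Summable fun m => acf s m * expo (-m) f := by
    refine Summable.of_norm ?_
    simpa [norm_expo] using hs.summable_acf
  have hsum2 : Summable fun m => ‖(momentWeight M g m : ℂ) * acf s m * expo (-m) f‖ := by
    simpa [norm_expo] using summable_momentWeight_mul hs M g
  have h1 : meanEstimate M g s σ f - (σ : ℂ) ^ 2 =
      ∑' m, (1 - (momentWeight M g m : ℂ)) * acf s m * expo (-m) f := by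
    rw [tsum_eq_sum (s := Finset.Ioo (-(M : ℤ)) M)]
    · simp only [meanEstimate, noisyAcf, mul_add, add_mul, Finset.sum_add_distrib]
      have h2 : ∑ m ∈ Finset.Ioo (-(M : ℤ)) M, ((g m * (1 - (|m| : ℤ) / (M : ℝ)) : ℝ) : ℂ) *
          (if m = 0 then (σ : ℂ) ^ 2 else 0) * expo (-m) f = (σ : ℂ) ^ 2 := by
        rw [Finset.sum_eq_single 0]
        · simp [hg.at_zero, expo_zero]
        · intro m _ hm; simp [hm]
        · simp [hM]
      rw [h2, add_sub_cancel_right]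
      refine Finset.sum_congr rfl fun m hm => ?_
      rw [Finset.mem_Ioo, ← abs_lt] at hm
      rw [momentWeight, if_pos hm]
      congr 2
      push_cast; ring
    · intro m hm
      rw [Finset.mem_Ioo, ← abs_lt] at hm
      simp [momentWeight, hm]
  have h3 : meanEstimate M g s σ f - (s f + (σ : ℝ) ^ 2 : ℝ) =
      -∑' m, (momentWeight M g m : ℂ) * acf s m * expo (-m) f := by
    have : meanEstimate M g s σ f - (s f + (σ : ℝ) ^ 2 : ℝ) =
        (meanEstimate M g s σ f - (σ : ℂ) ^ 2) - (s f : ℂ) := by push_cast; ring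
    rw [this, h1, hs.eq_fourierSeries hf, fourierSeries]
    have h4 := hsum2.of_norm
    rw [eq_neg_iff_add_eq_zero, sub_add_eq_add_sub, sub_eq_zero,
      ← Summable.tsum_add _ h4]
    · refine tsum_congr fun m => ?_
      ring
    · refine (hsum.sub h4).congr fun m => ?_
      ring
  rw [h3, norm_neg]
  refine (norm_tsum_le_tsum_norm hsum2).trans_eq ?_
  simp [acfMoment, norm_expo]

end

/-! ### Concentration of Gaussian quadratic forms -/

section

/-- An exponentiated form of `log (1 - y) ≥ -y - y²` near `0`. -/
lemma one_le_one_sub_mul_exp {y : ℝ} (hy : |y| ≤ 1 / 4) : 1 ≤ (1 - y) * Real.exp (y + y ^ 2) := by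
  obtain ⟨h1, h2⟩ := abs_le.mp hy
  rcases le_or_gt 0 y with h | h
  · have := Real.quadratic_le_exp_of_nonneg (x := y + y ^ 2) (by positivity)
    nlinarith [mul_le_mul_of_nonneg_left this (show 0 ≤ 1 - y by linarith), pow_nonneg h 2,
      pow_nonneg h 3, pow_nonneg h 4, mul_nonneg (pow_nonneg h 2) (show 0 ≤ 1 / 4 - y by linarith),
      mul_nonneg (pow_nonneg h 3) (show 0 ≤ 1 / 4 - y by linarith)]
  · have := Real.add_one_le_exp (y + y ^ 2)
    have h3 : y ^ 3 ≤ 0 := by nlinarith [sq_nonneg y]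
    nlinarith [mul_le_mul_of_nonneg_left this (show 0 ≤ 1 - y by linarith)]

lemma integral_exp_sq_sub_one {t : ℝ} (ht : t < 1 / 2) :
    ∫ x, Real.exp (t * (x ^ 2 - 1)) ∂gaussianReal 0 1 = Real.exp (-t) * (√(1 - 2 * t))⁻¹ := by
  rw [integral_gaussianReal_eq_integral_smul one_ne_zero]
  have h (x : ℝ) : gaussianPDFReal 0 1 x • Real.exp (t * (x ^ 2 - 1)) =
      (Real.exp (-t) * (√(2 * Real.pi))⁻¹) * Real.exp (-(1 / 2 - t) * x ^ 2) := by
    rw [gaussianPDFReal_def, smul_eq_mul]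
    simp only [NNReal.coe_one, mul_one, sub_zero]
    rw [mul_assoc, ← Real.exp_add, mul_comm (Real.exp (-t)), mul_assoc, ← Real.exp_add]
    congr 2; ring
  simp_rw [h]
  rw [integral_const_mul, integral_gaussian, mul_assoc]
  congr 1
  have hπ := Real.pi_pos
  rw [← Real.sqrt_inv, ← Real.sqrt_inv, ← Real.sqrt_mul (by positivity)]
  congr 1
  have : 1 - 2 * t ≠ 0 := by linarith
  have : 1 / 2 - t ≠ 0 := by linarith
  field_simp

lemma integrable_exp_sq_sub_one {t : ℝ} (ht : t < 1 / 2) :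
    Integrable (fun x => Real.exp (t * (x ^ 2 - 1))) (gaussianReal 0 1) := by
  refine Integrable.of_integral_ne_zero ?_
  rw [integral_exp_sq_sub_one ht]
  have : 0 < 1 - 2 * t := by linarith
  positivity

/-- A centred square of a standard Gaussian is sub-Gaussian for exponents near `0`. -/
lemma integral_exp_sq_sub_one_le {t : ℝ} (ht : |t| ≤ 1 / 8) :
    ∫ x, Real.exp (t * (x ^ 2 - 1)) ∂gaussianReal 0 1 ≤ Real.exp (2 * t ^ 2) := by
  obtain ⟨h1, h2⟩ := abs_le.mp ht
  rw [integral_exp_sq_sub_one (by linarith)]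
  have hpos : 0 < 1 - 2 * t := by linarith
  have hy := one_le_one_sub_mul_exp (y := 2 * t) (by rw [abs_le]; constructor <;> linarith)
  have h3 : Real.exp (-t) ≤ Real.exp (2 * t ^ 2) * √(1 - 2 * t) := by
    have : Real.exp (-t) ≤ √(Real.exp (2 * t ^ 2) ^ 2 * (1 - 2 * t)) := by
      refine Real.le_sqrt_of_sq_le ?_
      rw [← Real.exp_nat_mul, ← Real.exp_nat_mul]
      have e : Real.exp ((2 : ℕ) * (2 * t ^ 2)) =
          Real.exp (2 * t + (2 * t) ^ 2) * Real.exp ((2 : ℕ) * -t) := by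
        rw [← Real.exp_add]; congr 1; push_cast; ring
      rw [e]
      nlinarith [Real.exp_pos ((2 : ℕ) * -t)]
    rwa [Real.sqrt_mul (by positivity), Real.sqrt_sq (Real.exp_pos _).le] at this
  rwa [← div_eq_mul_inv, div_le_iff₀ (Real.sqrt_pos.mpr hpos)]

variable {ι : Type*} [Fintype ι]

/-- Chernoff's bound for weighted sums of centred squares of independent standard Gaussians, in the
regime of small deviations, where the tail is sub-Gaussian. -/
lemma measure_sum_mul_sq_sub_one_ge_le {l : ι → ℝ} {b δ : ℝ} (hb : 0 < b)
    (hl : ∀ i, |l i| ≤ b) (hδ : 0 ≤ δ) (hδ' : δ ≤ b * Fintype.card ι / 2) :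
    (Measure.pi fun _ : ι => gaussianReal 0 1).real {x | δ ≤ ∑ i, l i * (x i ^ 2 - 1)} ≤
      Real.exp (-δ ^ 2 / (8 * b ^ 2 * Fintype.card ι)) := by
  rcases isEmpty_or_nonempty ι with hι | hι
  · simp only [Fintype.card_eq_zero, Nat.cast_zero, mul_zero, div_zero, Real.exp_zero]
    exact measureReal_le_one
  have hn : (0 : ℝ) < Fintype.card ι := by exact_mod_cast Fintype.card_pos
  set n : ℝ := ((Fintype.card ι : ℕ) : ℝ)
  -- The minimizer of the Chernoff exponent `-θ δ + 2 θ² b² n`.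
  set θ : ℝ := δ / (4 * b ^ 2 * n) with hθ
  have hθ0 : 0 ≤ θ := by positivity
  have hθb : θ * b ≤ 1 / 8 := by
    rw [hθ, div_mul_eq_mul_div, div_le_iff₀ (by positivity)]
    nlinarith
  have ht (i : ι) : |θ * l i| ≤ 1 / 8 := by
    rw [abs_mul, abs_of_nonneg hθ0]
    exact (mul_le_mul_of_nonneg_left (hl i) hθ0).trans hθb
  have hexp (x : ι → ℝ) : Real.exp (θ * ∑ i, l i * (x i ^ 2 - 1)) =
      ∏ i, Real.exp (θ * l i * (x i ^ 2 - 1)) := by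
    rw [← Real.exp_sum, Finset.mul_sum]; simp_rw [mul_assoc]
  have hint : Integrable (fun x : ι → ℝ => Real.exp (θ * ∑ i, l i * (x i ^ 2 - 1)))
      (Measure.pi fun _ : ι => gaussianReal 0 1) := by
    simp_rw [hexp]
    exact Integrable.fintype_prod fun i =>
      integrable_exp_sq_sub_one (by linarith [(abs_le.mp (ht i)).2])
  refine (measure_ge_le_exp_mul_mgf δ hθ0 hint).trans ?_
  have hmgf : mgf (fun x : ι → ℝ => ∑ i, l i * (x i ^ 2 - 1))
      (Measure.pi fun _ : ι => gaussianReal 0 1) θ ≤ Real.exp (2 * (θ * b) ^ 2 * n) := by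
    rw [mgf]
    simp_rw [hexp]
    rw [integral_fintype_prod_eq_prod (f := fun i (x : ℝ) => Real.exp (θ * l i * (x ^ 2 - 1)))]
    calc ∏ i, ∫ x, Real.exp (θ * l i * (x ^ 2 - 1)) ∂gaussianReal 0 1
        ≤ ∏ _i : ι, Real.exp (2 * (θ * b) ^ 2) := by
          refine Finset.prod_le_prod (fun i _ => integral_nonneg fun x => (Real.exp_pos _).le)
            fun i _ => (integral_exp_sq_sub_one_le (ht i)).trans ?_
          rw [Real.exp_le_exp, mul_pow, mul_pow]
          have := sq_le_sq' (neg_le_of_abs_le (hl i)) (le_of_abs_le (hl i))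
          gcongr
      _ = Real.exp (2 * (θ * b) ^ 2 * n) := by
          rw [Finset.prod_const, ← Real.exp_nat_mul, Finset.card_univ, mul_comm]
  refine (mul_le_mul_of_nonneg_left hmgf (Real.exp_pos _).le).trans_eq ?_
  rw [← Real.exp_add, hθ]
  congr 1
  field_simp
  ring

lemma measure_abs_sum_mul_sq_sub_one_ge_le {l : ι → ℝ} {b δ : ℝ} (hb : 0 < b)
    (hl : ∀ i, |l i| ≤ b) (hδ : 0 ≤ δ) (hδ' : δ ≤ b * Fintype.card ι / 2) :
    (Measure.pi fun _ : ι => gaussianReal 0 1).real {x | δ ≤ |∑ i, l i * (x i ^ 2 - 1)|} ≤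
      2 * Real.exp (-δ ^ 2 / (8 * b ^ 2 * Fintype.card ι)) := by
  have h1 := measure_sum_mul_sq_sub_one_ge_le hb hl hδ hδ'
  have h2 := measure_sum_mul_sq_sub_one_ge_le (l := fun i => -l i) hb (by simpa using hl) hδ hδ'
  have : {x : ι → ℝ | δ ≤ |∑ i, l i * (x i ^ 2 - 1)|} ⊆
      {x | δ ≤ ∑ i, l i * (x i ^ 2 - 1)} ∪ {x | δ ≤ ∑ i, -l i * (x i ^ 2 - 1)} := by
    intro x hx
    have hx' : δ ≤ |∑ i, l i * (x i ^ 2 - 1)| := hx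
    rw [le_abs, ← Finset.sum_neg_distrib] at hx'
    simp_rw [← neg_mul] at hx'
    exact hx'
  linarith [measureReal_mono (μ := Measure.pi fun _ : ι => gaussianReal 0 1) this,
    measureReal_union_le (μ := Measure.pi fun _ : ι => gaussianReal 0 1)
      {x : ι → ℝ | δ ≤ ∑ i, l i * (x i ^ 2 - 1)} {x | δ ≤ ∑ i, -l i * (x i ^ 2 - 1)}]

open Matrix MatrixOrder in
/-- Concentration of a quadratic form `y ↦ y ⬝ K y` of a centred Gaussian vector with covariance
matrix `S`. In the eigenbasis of the symmetric part of `√S K √S` the form is a weighted sum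
`∑ λᵢ ξᵢ²` of squares of independent standard Gaussians, with weights `|λᵢ| ≤ β` of sum
`∑ λᵢ = tr (K S)`. -/
lemma measure_abs_quadForm_sub_ge_le [DecidableEq ι] {S K : Matrix ι ι ℝ} (hS : S.PosSemidef)
    {b δ : ℝ} (hb : 0 < b) (hSb : ∀ x : ι → ℝ, x ⬝ᵥ S *ᵥ x ≤ b * ∑ i, x i ^ 2)
    (hK : ∀ x : ι → ℝ, |x ⬝ᵥ K *ᵥ x| ≤ ∑ i, x i ^ 2)
    (hδ : 0 ≤ δ) (hδ' : δ ≤ b * Fintype.card ι / 2) :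
    (multivariateGaussian 0 S).real
        {y : EuclideanSpace ℝ ι | δ ≤ |y.ofLp ⬝ᵥ K *ᵥ y.ofLp - (K * S).trace|} ≤
      2 * Real.exp (-δ ^ 2 / (8 * b ^ 2 * Fintype.card ι)) := by
  set R : Matrix ι ι ℝ := CFC.sqrt S with hR
  have hRR : R * R = S := CFC.sqrt_mul_sqrt_self S (Matrix.nonneg_iff_posSemidef.mpr hS)
  have hRt : Rᵀ = R := by
    have : IsSelfAdjoint R := (CFC.sqrt_nonneg S).isSelfAdjoint
    rw [← Matrix.conjTranspose_eq_transpose_of_trivial]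
    exact this
  set N : Matrix ι ι ℝ := R * K * R with hN
  set A : Matrix ι ι ℝ := (1 / 2 : ℝ) • (N + Nᵀ) with hA
  have hAh : A.IsHermitian := by
    rw [Matrix.IsHermitian, Matrix.conjTranspose_eq_transpose_of_trivial, hA,
      Matrix.transpose_smul, Matrix.transpose_add, Matrix.transpose_transpose, add_comm]
  have hRq (z : ι → ℝ) : (R *ᵥ z) ⬝ᵥ K *ᵥ (R *ᵥ z) = z ⬝ᵥ A *ᵥ z := by
    have h1 : (R *ᵥ z) ⬝ᵥ K *ᵥ (R *ᵥ z) = z ⬝ᵥ N *ᵥ z := by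
      rw [hN, ← Matrix.mulVec_mulVec, ← Matrix.mulVec_mulVec, Matrix.dotProduct_mulVec z R,
        ← Matrix.mulVec_transpose, hRt]
    have h2 : z ⬝ᵥ Nᵀ *ᵥ z = z ⬝ᵥ N *ᵥ z := by
      rw [Matrix.mulVec_transpose, dotProduct_comm, ← Matrix.dotProduct_mulVec]
    rw [h1, hA, Matrix.smul_mulVec, Matrix.add_mulVec, dotProduct_smul, dotProduct_add, h2,
      smul_eq_mul]
    ring
  have hRn (z : ι → ℝ) : ∑ i, (R *ᵥ z) i ^ 2 = z ⬝ᵥ S *ᵥ z := by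
    rw [← hRR, ← Matrix.mulVec_mulVec, Matrix.dotProduct_mulVec z R, ← Matrix.mulVec_transpose,
      hRt, dotProduct]
    simp_rw [sq]
  have htr : ∑ i, hAh.eigenvalues i = (K * S).trace := by
    have h1 := hAh.trace_eq_sum_eigenvalues
    simp only [RCLike.ofReal_real_eq_id, id_eq] at h1
    rw [← h1, hA, Matrix.trace_smul, Matrix.trace_add, Matrix.trace_transpose, hN,
      Matrix.trace_mul_cycle, hRR, Matrix.trace_mul_comm, smul_eq_mul]
    ring
  set e := hAh.eigenvectorBasis with he
  have hAe (i : ι) : A *ᵥ (e i).ofLp = hAh.eigenvalues i • (e i).ofLp :=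
    hAh.mulVec_eigenvectorBasis i
  have hee (i j : ι) : (e i).ofLp ⬝ᵥ (e j).ofLp = if i = j then 1 else 0 := by
    have := orthonormal_iff_ite.mp e.orthonormal i j
    rw [EuclideanSpace.inner_eq_star_dotProduct, star_trivial, dotProduct_comm] at this
    exact this
  have hquad (x : ι → ℝ) : (∑ i, x i • e i).ofLp ⬝ᵥ A *ᵥ (∑ i, x i • e i).ofLp =
      ∑ i, hAh.eigenvalues i * x i ^ 2 := by
    rw [WithLp.ofLp_sum, Matrix.mulVec_sum, sum_dotProduct]
    refine Finset.sum_congr rfl fun i _ => ?_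
    simp only [WithLp.ofLp_smul, Matrix.mulVec_smul, hAe, dotProduct_sum, smul_dotProduct,
      dotProduct_smul, hee, smul_eq_mul]
    simp
    ring
  have hl (i : ι) : |hAh.eigenvalues i| ≤ b := by
    have h1 : (e i).ofLp ⬝ᵥ A *ᵥ (e i).ofLp = hAh.eigenvalues i := by
      rw [hAe, dotProduct_smul, hee]; simp
    rw [← h1, ← hRq]
    refine (hK _).trans ?_
    rw [hRn]
    refine (hSb _).trans_eq ?_
    have := hee i i
    simp only [dotProduct, ← sq, if_true] at this
    rw [this, mul_one]
  have hset : MeasurableSet {y : EuclideanSpace ℝ ι |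
      δ ≤ |y.ofLp ⬝ᵥ K *ᵥ y.ofLp - (K * S).trace|} := by
    refine measurableSet_le measurable_const (Continuous.measurable ?_)
    simp only [dotProduct, Matrix.mulVec]
    fun_prop
  have hf : Measurable fun x : EuclideanSpace ℝ ι =>
      0 + toEuclideanCLM (𝕜 := ℝ) (CFC.sqrt S) x := by fun_prop
  have hf2 : Measurable fun x : ι → ℝ => ∑ i, x i • e i := by fun_prop
  rw [multivariateGaussian, map_measureReal_apply hf hset,
    stdGaussian_eq_map_pi_orthonormalBasis e, map_measureReal_apply hf2 (hf hset)]
  refine le_trans (le_of_eq ?_) (measure_abs_sum_mul_sq_sub_one_ge_le hb hl hδ hδ')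
  congr 1
  ext x
  simp only [Set.mem_preimage, Set.mem_ofPred_eq, zero_add, Matrix.ofLp_toEuclideanCLM]
  rw [← hR, hRq, hquad, ← htr, ← Finset.sum_sub_distrib]
  simp_rw [mul_sub, mul_one]

end

/-! ### Gaussian vectors and conditioning -/

section

variable {Ω : Type*} [MeasurableSpace Ω] {P : Measure Ω}

section
variable {ι : Type*} [Fintype ι] {Z : ι → Ω → ℝ}

open Matrix in
lemma sum_sum_mul_eq_dotProduct_mulVec (S : Matrix ι ι ℝ) (x y : ι → ℝ) :
    ∑ i, ∑ j, x i * y j * S i j = x ⬝ᵥ S *ᵥ y := by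
  simp only [dotProduct, mulVec, Finset.mul_sum]
  exact Finset.sum_congr rfl fun i _ => Finset.sum_congr rfl fun j _ => by ring

lemma posSemidef_covariance [IsProbabilityMeasure P] (hZ : HasGaussianLaw (fun ω i => Z i ω) P) :
    (Matrix.of fun i j => cov[Z i, Z j; P]).PosSemidef := by
  refine Matrix.PosSemidef.of_dotProduct_mulVec_nonneg ?_ fun x => ?_
  · ext i j
    simp [covariance_comm (Z j)]
  · have h := covarianceBilin_self_nonneg (μ := P.map fun ω => WithLp.toLp 2 fun i => Z i ω)
      (WithLp.toLp 2 x : EuclideanSpace ℝ ι)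
    rw [covarianceBilin_apply_pi fun i => (hZ.eval i).memLp_two] at h
    rw [star_trivial, ← sum_sum_mul_eq_dotProduct_mulVec]
    exact h

/-- A centred Gaussian vector has the multivariate Gaussian law given by its covariances. -/
lemma map_toLp_eq_multivariateGaussian [DecidableEq ι] [IsProbabilityMeasure P]
    (hZ : HasGaussianLaw (fun ω i => Z i ω) P)
    (h0 : ∀ i, ∫ ω, Z i ω ∂P = 0) :
    P.map (fun ω => WithLp.toLp 2 fun i => Z i ω) =
      multivariateGaussian 0 (Matrix.of fun i j => cov[Z i, Z j; P]) := by
  have hG := hZ.toLp_pi 2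
  have := hG.isGaussian_map
  refine IsGaussian.ext ?_ ?_
  · simp only [id_eq]
    rw [integral_id_multivariateGaussian, integral_map hG.aemeasurable (by fun_prop)]
    ext i
    have h := ContinuousLinearMap.integral_comp_comm
      (EuclideanSpace.proj i : EuclideanSpace ℝ ι →L[ℝ] ℝ) hG.integrable
    exact h.symm.trans (h0 i)
  · ext x y
    rw [covarianceBilin_apply_pi fun i => (hZ.eval i).memLp_two,
      covarianceBilin_multivariateGaussian (posSemidef_covariance hZ),
      ← sum_sum_mul_eq_dotProduct_mulVec]
    rfl
end

/-- A bound for almost every value of an independent variable is an unconditional bound. -/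
lemma measureReal_le_of_indepFun [IsProbabilityMeasure P] {α β : Type*}
    [MeasurableSpace α] [MeasurableSpace β]
    {V : Ω → α} {Y : Ω → β} (hV : Measurable V) (hY : Measurable Y) (hVY : IndepFun V Y P)
    {D : Set (α × β)} (hD : MeasurableSet D) {ε : ℝ}
    (h : ∀ᵐ ω ∂P, (P.map Y).real {y | (V ω, y) ∈ D} ≤ ε) :
    P.real {ω | (V ω, Y ω) ∈ D} ≤ ε := by
  have hpY : IsProbabilityMeasure (P.map Y) := Measure.isProbabilityMeasure_map hY.aemeasurable
  have hε : 0 ≤ ε := by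
    obtain ⟨ω, hω⟩ := h.exists
    exact measureReal_nonneg.trans hω
  have h1 : P {ω | (V ω, Y ω) ∈ D} = ∫⁻ ω, (P.map Y) {y | (V ω, y) ∈ D} ∂P := by
    rw [show {ω | (V ω, Y ω) ∈ D} = (fun ω => (V ω, Y ω)) ⁻¹' D from rfl,
      ← Measure.map_apply (hV.prodMk hY) hD,
      (indepFun_iff_map_prod_eq_prod_map_map hV.aemeasurable hY.aemeasurable).mp hVY,
      Measure.prod_apply hD, lintegral_map (measurable_measure_prodMk_left hD) hV]
    rfl
  rw [Measure.real, h1]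
  refine ENNReal.toReal_le_of_le_ofReal hε ?_
  calc ∫⁻ ω, (P.map Y) {y | (V ω, y) ∈ D} ∂P ≤ ∫⁻ _, ENNReal.ofReal ε ∂P := by
        refine lintegral_mono_ae (h.mono fun ω hω => ?_)
        rwa [← ENNReal.ofReal_toReal (measure_ne_top (P.map Y) _),
          ENNReal.ofReal_le_ofReal_iff hε]
    _ = ENNReal.ofReal ε := by simp

/-! ### Sums over pairs of samples at a given lag -/

lemma sum_fin_ite_eq (M k : ℕ) (F : ℕ → ℝ) :
    ∑ j : Fin M, (if (j : ℕ) = k then F j else 0) = if k < M then F k else 0 := by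
  rw [Fin.sum_univ_eq_sum_range (fun j => if j = k then F j else 0)]
  simp

lemma sum_lag_eq (M m : ℕ) (F : ℕ → ℕ → ℝ) :
    ∑ i : Fin M, ∑ j : Fin M, (if (j : ℕ) = i + m then F i j else 0) =
      ∑ n ∈ Finset.range (M - m), F n (n + m) := by
  simp_rw [fun i : Fin M => sum_fin_ite_eq M (i + m) (F i)]
  rw [Fin.sum_univ_eq_sum_range (fun i => if i + m < M then F i (i + m) else 0),
    ← Finset.sum_filter]
  refine Finset.sum_congr ?_ fun _ _ => rfl
  ext n
  simp only [Finset.mem_filter, Finset.mem_range]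
  omega

/-- The (non-symmetric) matrix of the quadratic form `y ↦ ∑ₙ vₙ vₙ₊ₘ yₙ yₙ₊ₘ`. -/
def lagMatrix {M : ℕ} (m : ℕ) (v : Fin M → ℝ) : Matrix (Fin M) (Fin M) ℝ :=
  Matrix.of fun i j => if (j : ℕ) = i + m then v i * v j else 0

open Matrix in
lemma dotProduct_lagMatrix {M : ℕ} (m : ℕ) (v y : Fin M → ℝ) :
    y ⬝ᵥ lagMatrix m v *ᵥ y =
      ∑ i : Fin M, ∑ j : Fin M, if (j : ℕ) = i + m then v i * v j * (y i * y j) else 0 := by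
  rw [← sum_sum_mul_eq_dotProduct_mulVec]
  refine Finset.sum_congr rfl fun i _ => Finset.sum_congr rfl fun j _ => ?_
  simp only [lagMatrix, of_apply]
  split_ifs <;> ring

open Matrix in
lemma abs_dotProduct_lagMatrix_le {M : ℕ} (m : ℕ) {v : Fin M → ℝ} (hv : ∀ i, |v i| ≤ 1)
    (y : Fin M → ℝ) : |y ⬝ᵥ lagMatrix m v *ᵥ y| ≤ ∑ i, y i ^ 2 := by
  rw [dotProduct_lagMatrix]
  have h1 (i j : Fin M) : |if (j : ℕ) = i + m then v i * v j * (y i * y j) else 0| ≤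
      (if (j : ℕ) = i + m then y i ^ 2 / 2 else 0) +
        if (j : ℕ) = i + m then y j ^ 2 / 2 else 0 := by
    split_ifs
    · rw [abs_mul, abs_mul]
      have h2 : |v i| * |v j| ≤ 1 := mul_le_one₀ (hv i) (abs_nonneg _) (hv j)
      have h3 : |y i * y j| ≤ y i ^ 2 / 2 + y j ^ 2 / 2 := by
        rw [abs_le]; constructor <;> nlinarith [sq_nonneg (y i + y j), sq_nonneg (y i - y j)]
      exact (mul_le_of_le_one_left (abs_nonneg _) h2).trans h3
    · simp
  have h4 (i : Fin M) : ∑ j : Fin M, (if (j : ℕ) = i + m then y i ^ 2 / 2 else 0) ≤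
      y i ^ 2 / 2 := by
    rw [sum_fin_ite_eq M (i + m) fun _ => y i ^ 2 / 2]
    split_ifs
    · rfl
    · positivity
  have h5 (j : Fin M) : ∑ i : Fin M, (if (j : ℕ) = i + m then y j ^ 2 / 2 else 0) ≤
      y j ^ 2 / 2 := by
    have : ∑ i : Fin M, (if (j : ℕ) = i + m then y j ^ 2 / 2 else 0) ≤
        ∑ i : Fin M, (if (i : ℕ) = j - m then y j ^ 2 / 2 else 0) := by
      refine Finset.sum_le_sum fun i _ => ?_
      split_ifs with h h'
      · rfl
      · omega
      · positivity
      · rfl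
    refine this.trans ?_
    rw [sum_fin_ite_eq M (j - m) fun _ => y j ^ 2 / 2]
    split_ifs
    · rfl
    · positivity
  refine (Finset.abs_sum_le_sum_abs _ _).trans ?_
  refine (Finset.sum_le_sum fun i _ => (Finset.abs_sum_le_sum_abs _ _).trans
    (Finset.sum_le_sum fun j _ => h1 i j)).trans ?_
  simp_rw [Finset.sum_add_distrib]
  rw [Finset.sum_comm (f := fun i j : Fin M => if (j : ℕ) = i + m then y j ^ 2 / 2 else 0)]
  refine (add_le_add (Finset.sum_le_sum fun i _ => h4 i)
    (Finset.sum_le_sum fun j _ => h5 j)).trans_eq ?_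
  rw [← Finset.sum_add_distrib]
  exact Finset.sum_congr rfl fun i _ => by ring

/-! ### The signal and noise parts of a realization -/

variable {p : ℝ} {σ : NNReal} {s : ℝ → ℝ} {U X W : ℤ → Ω → ℝ}

lemma IsGaussianWithPSD.acf_eq_re (hX : IsGaussianWithPSD P s X) (m : ℤ) :
    acf s m = ((acf s m).re : ℂ) := by
  rw [← hX.autocorrelation 0 m, Complex.ofReal_re]

lemma IsRealization.indepFun_signal_noise (h : IsRealization P p σ s U X W) (i j : ℤ) :
    IndepFun (X i) (W j) P :=
  (h.indep.indepFun (i := 1) (j := 2) (by decide)).comp (measurable_pi_apply i)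
    (measurable_pi_apply j)

lemma IsRealization.memLp_signal (h : IsRealization P p σ s U X W) (i : ℤ) : MemLp (X i) 2 P :=
  (h.signal.gaussian.hasGaussianLaw_eval i).memLp_two

lemma IsRealization.memLp_noise (h : IsRealization P p σ s U X W) (i : ℤ) : MemLp (W i) 2 P :=
  (h.noise.law i).hasGaussianLaw.memLp_two

lemma IsRealization.integral_noise (h : IsRealization P p σ s U X W) (i : ℤ) :
    ∫ ω, W i ω ∂P = 0 := by
  rw [(h.noise.law i).integral_eq, integral_id_gaussianReal]

lemma IsRealization.integral_add [IsProbabilityMeasure P]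
    (h : IsRealization P p σ s U X W) (i : ℤ) :
    ∫ ω, (X i ω + W i ω) ∂P = 0 := by
  rw [MeasureTheory.integral_add ((h.memLp_signal i).integrable one_le_two)
    ((h.memLp_noise i).integrable one_le_two), h.signal.mean_zero, h.integral_noise, add_zero]

lemma IsRealization.covariance_signal [IsProbabilityMeasure P]
    (h : IsRealization P p σ s U X W) (i j : ℤ) :
    cov[X i, X j; P] = (acf s (i - j)).re := by
  rw [covariance_eq_sub (h.memLp_signal i) (h.memLp_signal j), h.signal.mean_zero, zero_mul,
    sub_zero, ← h.signal.autocorrelation j (i - j), Complex.ofReal_re, add_sub_cancel]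
  rfl

lemma IsRealization.covariance_noise [IsProbabilityMeasure P]
    (h : IsRealization P p σ s U X W) (i j : ℤ) :
    cov[W i, W j; P] = if i = j then (σ : ℝ) ^ 2 else 0 := by
  split_ifs with hij
  · subst hij
    rw [covariance_self (h.noise.measurable i).aemeasurable, (h.noise.law i).variance_eq,
      variance_id_gaussianReal, NNReal.coe_pow]
  · exact (h.noise.indep.indepFun hij).covariance_eq_zero (h.memLp_noise i) (h.memLp_noise j)

lemma noisyAcf_re (s : ℝ → ℝ) (σ : NNReal) (m : ℤ) :
    (noisyAcf s σ m).re = (acf s m).re + if m = 0 then (σ : ℝ) ^ 2 else 0 := by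
  have h : ((σ : ℂ) ^ 2).re = (σ : ℝ) ^ 2 := by
    rw [← Complex.ofReal_pow, Complex.ofReal_re]
  rw [noisyAcf, Complex.add_re]
  split_ifs <;> simp [h]

lemma IsRealization.covariance_add [IsProbabilityMeasure P]
    (h : IsRealization P p σ s U X W) (i j : ℤ) :
    cov[fun ω => X i ω + W i ω, fun ω => X j ω + W j ω; P] = (noisyAcf s σ (i - j)).re := by
  change cov[X i + W i, X j + W j; P] = _
  rw [covariance_add_left (h.memLp_signal i) (h.memLp_noise i)
      ((h.memLp_signal j).add (h.memLp_noise j)),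
    covariance_add_right (h.memLp_signal i) (h.memLp_signal j) (h.memLp_noise j),
    covariance_add_right (h.memLp_noise i) (h.memLp_signal j) (h.memLp_noise j),
    h.covariance_signal, h.covariance_noise,
    (h.indepFun_signal_noise i j).covariance_eq_zero (h.memLp_signal i) (h.memLp_noise j),
    (h.indepFun_signal_noise j i).symm.covariance_eq_zero (h.memLp_noise i) (h.memLp_signal j),
    noisyAcf_re]
  simp only [add_zero, zero_add, sub_eq_zero]

lemma hasGaussianLaw_pi_comp {ι : Type*} [Fintype ι] (hX : IsGaussianProcess X P) (k : ι → ℤ) :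
    HasGaussianLaw (fun ω i => X (k i) ω) P := by
  classical
  let I : Finset ℤ := Finset.univ.image k
  exact (hX.hasGaussianLaw I).map_fun (ContinuousLinearMap.pi fun i : ι =>
    ContinuousLinearMap.proj (R := ℝ) (φ := fun _ : I => ℝ)
      ⟨k i, Finset.mem_image_of_mem k (Finset.mem_univ i)⟩)

lemma IsRealization.hasGaussianLaw_add [IsProbabilityMeasure P] {ι : Type*} [Fintype ι]
    (h : IsRealization P p σ s U X W) {k : ι → ℤ} (hk : Function.Injective k) :
    HasGaussianLaw (fun ω i => X (k i) ω + W (k i) ω) P := by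
  have hX := hasGaussianLaw_pi_comp h.signal.gaussian k
  have hW : HasGaussianLaw (fun ω i => W (k i) ω) P :=
    iIndepFun.hasGaussianLaw (X := fun i => W (k i)) (fun i => (h.noise.law (k i)).hasGaussianLaw)
      (h.noise.indep.precomp hk)
  have hind : IndepFun (fun ω i => X (k i) ω) (fun ω i => W (k i) ω) P :=
    (h.indep.indepFun (i := 1) (j := 2) (by decide)).comp
      (φ := fun (x : ℤ → ℝ) i => x (k i)) (ψ := fun (x : ℤ → ℝ) i => x (k i))
      (by fun_prop) (by fun_prop)
  exact iIndepFun.hasGaussianLaw_add hX hW hind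

lemma IsRealization.indepFun_sampling {ι κ : Type*} (h : IsRealization P p σ s U X W)
    (k : κ → ℤ) (k' : ι → ℤ) :
    IndepFun (fun ω i => U (k i) ω) (fun ω i => X (k' i) ω + W (k' i) ω) P := by
  have hm : ∀ i, Measurable ((![fun ω m => U m ω, fun ω m => X m ω, fun ω m => W m ω] :
      Fin 3 → Ω → ℤ → ℝ) i) := by
    intro i
    fin_cases i
    · exact measurable_pi_iff.mpr h.sampling.measurable
    · exact measurable_pi_iff.mpr h.signal.measurable
    · exact measurable_pi_iff.mpr h.noise.measurable
  have h1 := (h.indep.indepFun_prodMk hm 1 2 0 (by decide) (by decide)).symm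
  exact h1.comp (φ := fun (u : ℤ → ℝ) i => u (k i))
    (ψ := fun (xw : (ℤ → ℝ) × (ℤ → ℝ)) i => xw.1 (k' i) + xw.2 (k' i))
    (by fun_prop) (by fun_prop)

lemma IsBernoulliProcess.ae_eq_zero_or_one [IsProbabilityMeasure P]
    (hU : IsBernoulliProcess P p U) (m : ℤ) :
    ∀ᵐ ω ∂P, U m ω = 0 ∨ U m ω = 1 := by
  have h0 : MeasurableSet {ω | U m ω = 0} := hU.measurable m (measurableSet_singleton 0)
  have h1 : MeasurableSet {ω | U m ω = 1} := hU.measurable m (measurableSet_singleton 1)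
  have hd : Disjoint {ω | U m ω = 0} {ω | U m ω = 1} :=
    Set.disjoint_left.mpr fun ω (h : U m ω = 0) (h' : U m ω = 1) => zero_ne_one (h.symm.trans h')
  have h := measureReal_union (μ := P) hd h1
  rw [hU.prob_zero, hU.prob_one, sub_add_cancel] at h
  have h2 : P.real ({ω | U m ω = 0} ∪ {ω | U m ω = 1})ᶜ = 0 := by
    rw [probReal_compl_eq_one_sub (h0.union h1), h, sub_self]
  rw [measureReal_eq_zero_iff] at h2
  exact h2

/-- Given the sampling process, the lag products of an observation form a Gaussian quadratic form,
which concentrates around its conditional mean. -/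
lemma IsRealization.measure_lag_sum_sub_ge_le [IsProbabilityMeasure P]
    (h : IsRealization P p σ s U X W) (hs : IsNormalizedPSD s) {B : ℝ}
    (hB : ∀ f ∈ Set.Ico (0 : ℝ) 1, s f ≤ B)
    (hBσ : 0 < B + (σ : ℝ) ^ 2) (t : ℤ) (M m : ℕ) {δ : ℝ} (hδ : 0 ≤ δ)
    (hδ' : δ ≤ (B + (σ : ℝ) ^ 2) * M / 2) :
    P.real {ω | δ ≤ |∑ n ∈ Finset.range (M - m),
        observation U X W t ω (n + m) * observation U X W t ω n -
        (noisyAcf s σ m).re * ∑ n ∈ Finset.range (M - m), U (t + n) ω * U (t + (n + m : ℕ)) ω|} ≤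
      2 * Real.exp (-δ ^ 2 / (8 * (B + (σ : ℝ) ^ 2) ^ 2 * M)) := by
  set k : Fin M → ℤ := fun i => t + (i : ℕ) with hk
  have hkinj : Function.Injective k := fun i j hij => by
    simp only [hk] at hij
    exact Fin.ext (by omega)
  set S : Matrix (Fin M) (Fin M) ℝ :=
    Matrix.of fun i j => cov[fun ω => X (k i) ω + W (k i) ω, fun ω => X (k j) ω + W (k j) ω; P]
  have hSij (i j : Fin M) : S i j = (noisyAcf s σ (k i - k j)).re := h.covariance_add _ _
  have hG := h.hasGaussianLaw_add hkinj
  have hSpsd : S.PosSemidef := posSemidef_covariance hG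
  set V : Ω → Fin M → ℝ := fun ω i => U (k i) ω
  set Y : Ω → EuclideanSpace ℝ (Fin M) :=
    fun ω => WithLp.toLp 2 fun i => X (k i) ω + W (k i) ω with hYdef
  have hY : P.map Y = multivariateGaussian 0 S :=
    map_toLp_eq_multivariateGaussian hG fun i => h.integral_add _
  have hVm : Measurable V := measurable_pi_iff.mpr fun i => h.sampling.measurable _
  have hYm' : Measurable fun ω (i : Fin M) => X (k i) ω + W (k i) ω :=
    measurable_pi_iff.mpr fun i => (h.signal.measurable _).add (h.noise.measurable _)
  have hYm : Measurable Y := (by fun_prop : Measurable (WithLp.toLp 2 : (Fin M → ℝ) → _)).comp hYm'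
  have hVY : IndepFun V Y P := (h.indepFun_sampling k k).comp (φ := id) measurable_id
    (by fun_prop : Measurable (WithLp.toLp 2 : (Fin M → ℝ) → EuclideanSpace ℝ (Fin M)))
  have hSb (x : Fin M → ℝ) :
      dotProduct x (S.mulVec x) ≤ (B + (σ : ℝ) ^ 2) * ∑ i, x i ^ 2 := by
    rw [← sum_sum_mul_eq_dotProduct_mulVec, add_mul]
    have h1 := sum_mul_acf_le hs hB x hkinj
    have h2 : ∑ i, ∑ j, x i * x j * S i j =
        ∑ i, ∑ j, x i * x j * (acf s (k i - k j)).re + (σ : ℝ) ^ 2 * ∑ i, x i ^ 2 := by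
      rw [Finset.mul_sum, ← Finset.sum_add_distrib]
      refine Finset.sum_congr rfl fun i _ => ?_
      have h3 (j : Fin M) : x i * x j * S i j = x i * x j * (acf s (k i - k j)).re +
          if i = j then (σ : ℝ) ^ 2 * x i ^ 2 else 0 := by
        simp only [hSij, noisyAcf_re, mul_add, sub_eq_zero, hkinj.eq_iff]
        split_ifs with hij
        · subst hij; ring
        · simp
      simp_rw [h3, Finset.sum_add_distrib]
      simp
    linarith
  set D : Set ((Fin M → ℝ) × EuclideanSpace ℝ (Fin M)) :=
    {vy | δ ≤ |dotProduct vy.2.ofLp ((lagMatrix m vy.1).mulVec vy.2.ofLp) -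
      (lagMatrix m vy.1 * S).trace|} with hDdef
  have hDm : MeasurableSet D := by
    refine measurableSet_le measurable_const (Continuous.measurable ?_)
    have hc (i j : Fin M) : Continuous fun vy : (Fin M → ℝ) × EuclideanSpace ℝ (Fin M) =>
        lagMatrix m vy.1 i j := by
      simp only [lagMatrix, Matrix.of_apply]
      split_ifs <;> fun_prop
    simp only [dotProduct, Matrix.mulVec, Matrix.trace, Matrix.diag, Matrix.mul_apply]
    fun_prop
  have hmain : P.real {ω | (V ω, Y ω) ∈ D} ≤
      2 * Real.exp (-δ ^ 2 / (8 * (B + (σ : ℝ) ^ 2) ^ 2 * M)) := by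
    refine measureReal_le_of_indepFun hVm hYm hVY hDm ?_
    have hae : ∀ᵐ ω ∂P, ∀ i : Fin M, U (k i) ω = 0 ∨ U (k i) ω = 1 :=
      ae_all_iff.mpr fun i => h.sampling.ae_eq_zero_or_one _
    refine hae.mono fun ω hω => ?_
    rw [hY]
    have := measure_abs_quadForm_sub_ge_le hSpsd hBσ hSb
      (abs_dotProduct_lagMatrix_le m (v := V ω) fun i => by
        rcases hω i with h0 | h0 <;> simp [V, h0]) hδ (by rwa [Fintype.card_fin])
    rwa [Fintype.card_fin] at this
  refine le_trans (le_of_eq ?_) hmain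
  congr 1
  ext ω
  simp only [hDdef, Set.mem_ofPred_eq]
  have e1 : dotProduct (Y ω).ofLp ((lagMatrix m (V ω)).mulVec (Y ω).ofLp) =
      ∑ n ∈ Finset.range (M - m),
        observation U X W t ω (n + m) * observation U X W t ω n := by
    rw [dotProduct_lagMatrix, ← sum_lag_eq M m fun n n' =>
      observation U X W t ω n' * observation U X W t ω n]
    refine Finset.sum_congr rfl fun i _ => Finset.sum_congr rfl fun j _ => ?_
    split_ifs
    · simp only [observation, V, hYdef, hk]; ring
    · rfl
  have e2 : (lagMatrix m (V ω) * S).trace = (noisyAcf s σ m).re *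
      ∑ n ∈ Finset.range (M - m), U (t + n) ω * U (t + (n + m : ℕ)) ω := by
    rw [← sum_lag_eq M m fun n n' => U (t + n) ω * U (t + n') ω, Finset.mul_sum]
    simp only [Matrix.trace, Matrix.diag, Matrix.mul_apply]
    refine Finset.sum_congr rfl fun i _ => ?_
    rw [Finset.mul_sum]
    refine Finset.sum_congr rfl fun j _ => ?_
    simp only [lagMatrix, Matrix.of_apply]
    split_ifs with hij
    · rw [hSij, show k j - k i = m by simp only [hk, hij]; push_cast; ring]
      simp only [V, hk]; ring
    · simp
  rw [e1, e2]

end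

/-! ### Concentration of lagged products of a Bernoulli process -/

section

variable {Ω : Type*} [MeasurableSpace Ω] {P : Measure Ω}

/-- Adding `a * V` to `S`, where `V` is sub-Gaussian and independent of `S` and of the weight
`|a| ≤ 1`, adds the variance proxies: integrate over `V` first. -/
lemma hasSubgaussianMGF_add_mul_of_indepFun [IsProbabilityMeasure P] {S a V : Ω → ℝ}
    {c c' : NNReal} (hS : HasSubgaussianMGF S c P) (hV : HasSubgaussianMGF V c' P)
    (hSm : Measurable S) (ham : Measurable a) (hVm : Measurable V)
    (ha : ∀ᵐ ω ∂P, |a ω| ≤ 1) (hind : IndepFun (fun ω => (S ω, a ω)) V P) :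
    HasSubgaussianMGF (fun ω => S ω + a ω * V ω) (c + c') P := by
  have hlin (t : ℝ) : ∫⁻ ω, ENNReal.ofReal (Real.exp (t * (S ω + a ω * V ω))) ∂P ≤
      ENNReal.ofReal (Real.exp ((c + c' : NNReal) * t ^ 2 / 2)) := by
    have hF : Measurable fun z : (ℝ × ℝ) × ℝ =>
        ENNReal.ofReal (Real.exp (t * (z.1.1 + z.1.2 * z.2))) := by fun_prop
    have hSa : Measurable fun ω => (S ω, a ω) := hSm.prodMk ham
    have hpV : IsProbabilityMeasure (P.map V) := Measure.isProbabilityMeasure_map hVm.aemeasurable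
    have hinner (r b : ℝ) (hb : |b| ≤ 1) :
        ∫⁻ v, ENNReal.ofReal (Real.exp (t * (r + b * v))) ∂P.map V ≤
          ENNReal.ofReal (Real.exp (c' * t ^ 2 / 2)) * ENNReal.ofReal (Real.exp (t * r)) := by
      rw [lintegral_map (by fun_prop) hVm]
      have e (ω : Ω) : ENNReal.ofReal (Real.exp (t * (r + b * V ω))) =
          ENNReal.ofReal (Real.exp (t * r)) * ENNReal.ofReal (Real.exp (t * b * V ω)) := by
        rw [← ENNReal.ofReal_mul (Real.exp_pos _).le, ← Real.exp_add]; ring_nf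
      simp_rw [e]
      rw [lintegral_const_mul _ (by fun_prop), mul_comm]
      gcongr
      rw [← ofReal_integral_eq_lintegral_ofReal (hV.integrable_exp_mul (t * b))
        (Filter.Eventually.of_forall fun ω => (Real.exp_pos _).le)]
      refine ENNReal.ofReal_le_ofReal ((hV.mgf_le (t * b)).trans ?_)
      rw [Real.exp_le_exp, mul_pow]
      have hb2 : b ^ 2 ≤ 1 := by rw [← sq_abs]; exact pow_le_one₀ (abs_nonneg b) hb
      have : t ^ 2 * b ^ 2 ≤ t ^ 2 := mul_le_of_le_one_right (sq_nonneg t) hb2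
      gcongr
    calc ∫⁻ ω, ENNReal.ofReal (Real.exp (t * (S ω + a ω * V ω))) ∂P
        = ∫⁻ z, ENNReal.ofReal (Real.exp (t * (z.1.1 + z.1.2 * z.2)))
            ∂P.map (fun ω => ((S ω, a ω), V ω)) := by
          rw [lintegral_map hF (hSa.prodMk hVm)]
      _ = ∫⁻ ω, ∫⁻ v, ENNReal.ofReal (Real.exp (t * (S ω + a ω * v))) ∂P.map V ∂P := by
          rw [(indepFun_iff_map_prod_eq_prod_map_map hSa.aemeasurable hVm.aemeasurable).mp hind,
            lintegral_prod _ hF.aemeasurable, lintegral_map hF.lintegral_prod_right' hSa]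
      _ ≤ ∫⁻ ω, ENNReal.ofReal (Real.exp (c' * t ^ 2 / 2)) *
            ENNReal.ofReal (Real.exp (t * S ω)) ∂P :=
          lintegral_mono_ae (ha.mono fun ω hω => hinner _ _ hω)
      _ = ENNReal.ofReal (Real.exp (c' * t ^ 2 / 2)) * ENNReal.ofReal (mgf S P t) := by
          rw [lintegral_const_mul _ (by fun_prop), mgf,
            ofReal_integral_eq_lintegral_ofReal (hS.integrable_exp_mul t)
              (Filter.Eventually.of_forall fun ω => (Real.exp_pos _).le)]
      _ ≤ ENNReal.ofReal (Real.exp (c' * t ^ 2 / 2)) *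
            ENNReal.ofReal (Real.exp (c * t ^ 2 / 2)) := by
          gcongr
          exact hS.mgf_le t
      _ = ENNReal.ofReal (Real.exp ((c + c' : NNReal) * t ^ 2 / 2)) := by
          rw [← ENNReal.ofReal_mul (Real.exp_pos _).le, ← Real.exp_add]
          congr 2; push_cast; ring
  have hint (t : ℝ) : Integrable (fun ω => Real.exp (t * (S ω + a ω * V ω))) P := by
    refine ⟨Measurable.aestronglyMeasurable (by fun_prop), ?_⟩
    rw [hasFiniteIntegral_iff_ofReal (Filter.Eventually.of_forall fun ω => (Real.exp_pos _).le)]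
    exact (hlin t).trans_lt ENNReal.ofReal_lt_top
  refine ⟨hint, fun t => ?_⟩
  rw [mgf, ← ENNReal.ofReal_le_ofReal_iff (Real.exp_pos _).le,
    ofReal_integral_eq_lintegral_ofReal (hint t)
      (Filter.Eventually.of_forall fun ω => (Real.exp_pos _).le)]
  exact hlin t

lemma measure_abs_ge_le_of_hasSubgaussianMGF [IsProbabilityMeasure P] {S : Ω → ℝ} {c : NNReal}
    (hS : HasSubgaussianMGF S c P) {ε : ℝ} (hε : 0 ≤ ε) :
    P.real {ω | ε ≤ |S ω|} ≤ 2 * Real.exp (-ε ^ 2 / (2 * c)) := by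
  have h1 := hS.measure_ge_le hε
  have h2 := hS.neg.measure_ge_le hε
  have h3 : {ω | ε ≤ |S ω|} ⊆ {ω | ε ≤ S ω} ∪ {ω | ε ≤ (-S) ω} := by
    intro ω (hω : ε ≤ |S ω|)
    rw [le_abs] at hω
    exact hω
  linarith [measureReal_mono (μ := P) h3,
    measureReal_union_le (μ := P) {ω | ε ≤ S ω} {ω | ε ≤ (-S) ω}]

variable {p : ℝ} {U : ℤ → Ω → ℝ}

lemma IsBernoulliProcess.integral_eq [IsProbabilityMeasure P] (hU : IsBernoulliProcess P p U)
    (m : ℤ) : ∫ ω, U m ω ∂P = p := by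
  have h1 : MeasurableSet {ω | U m ω = 1} := hU.measurable m (measurableSet_singleton 1)
  rw [← hU.prob_one m, ← integral_indicator_one h1]
  refine integral_congr_ae ((hU.ae_eq_zero_or_one m).mono fun ω hω => ?_)
  rcases hω with h | h <;> simp [Set.indicator, h]

/-- Hoeffding's lemma for a centred Bernoulli variable. -/
lemma IsBernoulliProcess.hasSubgaussianMGF [IsProbabilityMeasure P]
    (hU : IsBernoulliProcess P p U) (m : ℤ) :
    HasSubgaussianMGF (fun ω => U m ω - p) (1 / 4) P := by
  have h := hasSubgaussianMGF_of_mem_Icc (hU.measurable m).aemeasurable (a := 0) (b := 1)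
    ((hU.ae_eq_zero_or_one m).mono fun ω hω => by rcases hω with h | h <;> simp [h])
  rw [hU.integral_eq] at h
  convert h using 1
  rw [sub_zero, nnnorm_one]; norm_num

lemma IsBernoulliProcess.hasSubgaussianMGF_sum [IsProbabilityMeasure P]
    (hU : IsBernoulliProcess P p U) (t : ℤ) (k : ℕ) :
    HasSubgaussianMGF (fun ω => ∑ n ∈ Finset.range k, (U (t + n) ω - p)) (k / 4) P := by
  have hinj : Function.Injective fun n : ℕ => t + (n : ℤ) := fun a b h => by
    simpa using h
  have h := HasSubgaussianMGF.sum_of_iIndepFun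
    (X := fun (n : ℕ) ω => U (t + n) ω - p) (c := fun _ => 1 / 4) (μ := P) (s := Finset.range k)
    ((hU.indep.precomp hinj).comp (fun _ x => x - p) fun _ => by fun_prop)
    fun n _ => hU.hasSubgaussianMGF _
  convert h using 1
  rw [Finset.sum_const, Finset.card_range, nsmul_eq_mul]; ring

/-- The sum `∑ₙ U[n] (U[n+m] - p)` is a martingale with bounded increments when `m > 0`. -/
lemma IsBernoulliProcess.hasSubgaussianMGF_lag_sum [IsProbabilityMeasure P]
    (hU : IsBernoulliProcess P p U) (t : ℤ) {m : ℕ} (hm : 0 < m) (k : ℕ) :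
    HasSubgaussianMGF
      (fun ω => ∑ n ∈ Finset.range k, U (t + n) ω * (U (t + (n + m : ℕ)) ω - p)) (k / 4) P := by
  have hinj : Function.Injective fun n : ℕ => t + (n : ℤ) := fun a b h => by
    simpa using h
  have hUm := hU.measurable
  induction k with
  | zero => simp
  | succ k ih =>
    have hind : IndepFun (fun ω => (∑ n ∈ Finset.range k,
        U (t + n) ω * (U (t + (n + m : ℕ)) ω - p), U (t + k) ω))
        (fun ω => U (t + (k + m : ℕ)) ω - p) P := by
      -- Both entries of the pair are functions of the samples with index below `k + m`.
      have h := (hU.indep.precomp hinj).indepFun_finset (Finset.range (k + m)) {k + m}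
        (by simp) fun n => hUm _
      let x : (Finset.range (k + m) → ℝ) → ℕ → ℝ := fun y n =>
        if hn : n ∈ Finset.range (k + m) then y ⟨n, hn⟩ else 0
      have hx (n : ℕ) : Measurable fun y => x y n := by
        simp only [x]
        split_ifs <;> fun_prop
      have h2 := h.comp
        (φ := fun y => (∑ n ∈ Finset.range k, x y n * (x y (n + m) - p), x y k))
        (ψ := fun y : ({k + m} : Finset ℕ) → ℝ => y ⟨k + m, by simp⟩ - p)
        (by fun_prop) (by fun_prop)
      convert h2 using 1
      · funext ω
        have hxe (n : ℕ) (hn : n < k + m) :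
            x (fun i : Finset.range (k + m) => U (t + (i : ℕ)) ω) n = U (t + n) ω := by
          simp [x, hn]
        simp only [Function.comp_apply, Prod.mk.injEq]
        refine ⟨Finset.sum_congr rfl fun n hn => ?_, (hxe k (by omega)).symm⟩
        rw [Finset.mem_range] at hn
        rw [hxe n (by omega), hxe (n + m) (by omega)]
      · rfl
    have h := hasSubgaussianMGF_add_mul_of_indepFun ih
      (hU.hasSubgaussianMGF (t + (k + m : ℕ))) (by fun_prop) (hUm _) (by fun_prop)
      ((hU.ae_eq_zero_or_one (t + k)).mono fun ω hω => by rcases hω with h | h <;> simp [h]) hind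
    simp_rw [Finset.sum_range_succ]
    convert h using 1
    push_cast; ring

/-- The number of available pairs of samples at lag `m` concentrates around its mean, by the
decomposition `U[n] U[n+m] - p² = U[n] (U[n+m] - p) + p (U[n] - p)` for `m ≠ 0`, and
`U[n]² = U[n]` for `m = 0`. -/
lemma IsBernoulliProcess.measure_lag_sum_sub_ge_le [IsProbabilityMeasure P]
    (hU : IsBernoulliProcess P p U) (hp : 0 ≤ p) (t : ℤ) {M m : ℕ} (hm : m < M) {ε : ℝ}
    (hε : 0 ≤ ε) :
    P.real {ω | (1 + p) * ε ≤ |∑ n ∈ Finset.range (M - m), U (t + n) ω * U (t + (n + m : ℕ)) ω -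
        (M - m) * samplingWeight p m|} ≤ 4 * Real.exp (-2 * ε ^ 2 / M) := by
  have hk : (0 : ℝ) < ((M - m : ℕ) : ℝ) := by exact_mod_cast Nat.sub_pos_of_lt hm
  have hkM : ((M - m : ℕ) : ℝ) ≤ M := by exact_mod_cast Nat.sub_le M m
  have hcast : ((M - m : ℕ) : ℝ) = (M : ℝ) - m := Nat.cast_sub hm.le
  have hexp : Real.exp (-ε ^ 2 / (2 * (((M - m : ℕ) : NNReal) / 4 : NNReal))) ≤
      Real.exp (-2 * ε ^ 2 / M) := by
    rw [Real.exp_le_exp]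
    rw [NNReal.coe_div, NNReal.coe_natCast, NNReal.coe_ofNat]
    rw [show -2 * ε ^ 2 / (M : ℝ) = -(2 * ε ^ 2 / M) by ring,
      show -ε ^ 2 / (2 * (((M - m : ℕ) : ℝ) / 4)) = -(2 * ε ^ 2 / ((M - m : ℕ) : ℝ)) by
        field_simp; ring, neg_le_neg_iff]
    gcongr
  have h2 := (measure_abs_ge_le_of_hasSubgaussianMGF (hU.hasSubgaussianMGF_sum t (M - m)) hε).trans
    (mul_le_mul_of_nonneg_left hexp zero_le_two)
  rcases Nat.eq_zero_or_pos m with rfl | hm0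
  · have hae : ∀ᵐ ω ∂P, ∀ n : ℕ, U (t + n) ω = 0 ∨ U (t + n) ω = 1 :=
      ae_all_iff.mpr fun n => hU.ae_eq_zero_or_one _
    have h3 : P.real {ω | (1 + p) * ε ≤ |∑ n ∈ Finset.range (M - 0),
        U (t + n) ω * U (t + (n + 0 : ℕ)) ω - (M - (0 : ℕ)) * samplingWeight p (0 : ℕ)|} ≤
        P.real {ω | ε ≤ |∑ n ∈ Finset.range (M - 0), (U (t + n) ω - p)|} := by
      refine ENNReal.toReal_mono (measure_ne_top _ _) (measure_mono_ae ?_)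
      refine hae.mono fun ω hω h => ?_
      have h' : (1 + p) * ε ≤ |∑ n ∈ Finset.range (M - 0),
        U (t + n) ω * U (t + (n + 0 : ℕ)) ω - (M - (0 : ℕ)) * samplingWeight p (0 : ℕ)| := h
      have e : ∑ n ∈ Finset.range (M - 0), (U (t + n) ω - p) =
          ∑ n ∈ Finset.range (M - 0), U (t + n) ω * U (t + (n + 0 : ℕ)) ω -
            (M - (0 : ℕ)) * samplingWeight p (0 : ℕ) := by
        rw [Finset.sum_sub_distrib]
        congr 1
        · refine Finset.sum_congr rfl fun n _ => ?_
          rw [add_zero]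
          rcases hω n with h0 | h0 <;> simp [h0]
        · simp [samplingWeight]
      change ε ≤ |∑ n ∈ Finset.range (M - 0), (U (t + n) ω - p)|
      rw [e]
      nlinarith
    have := Real.exp_pos (-2 * ε ^ 2 / M)
    exact (h3.trans h2).trans (by linarith)
  · have h1 := (measure_abs_ge_le_of_hasSubgaussianMGF
      (hU.hasSubgaussianMGF_lag_sum t hm0 (M - m)) hε).trans
      (mul_le_mul_of_nonneg_left hexp zero_le_two)
    have hsub : {ω | (1 + p) * ε ≤ |∑ n ∈ Finset.range (M - m),
        U (t + n) ω * U (t + (n + m : ℕ)) ω - (M - m) * samplingWeight p m|} ⊆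
        {ω | ε ≤ |∑ n ∈ Finset.range (M - m), U (t + n) ω * (U (t + (n + m : ℕ)) ω - p)|} ∪
        {ω | ε ≤ |∑ n ∈ Finset.range (M - m), (U (t + n) ω - p)|} := by
      intro ω hω
      by_contra hcon
      obtain ⟨hc1, hc2⟩ := not_or.mp hcon
      have hc1' : |∑ n ∈ Finset.range (M - m), U (t + n) ω * (U (t + (n + m : ℕ)) ω - p)| < ε :=
        not_le.mp hc1
      have hc2' : |∑ n ∈ Finset.range (M - m), (U (t + n) ω - p)| < ε := not_le.mp hc2
      have hω' : (1 + p) * ε ≤ |∑ n ∈ Finset.range (M - m),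
        U (t + n) ω * U (t + (n + m : ℕ)) ω - (M - m) * samplingWeight p m| := hω
      have e : ∑ n ∈ Finset.range (M - m), U (t + n) ω * U (t + (n + m : ℕ)) ω -
          (M - m) * samplingWeight p m =
          ∑ n ∈ Finset.range (M - m), U (t + n) ω * (U (t + (n + m : ℕ)) ω - p) +
            p * ∑ n ∈ Finset.range (M - m), (U (t + n) ω - p) := by
        have hm1 : (m : ℤ) ≠ 0 := by omega
        rw [samplingWeight, if_neg hm1, ← hcast, Finset.mul_sum, ← Finset.sum_add_distrib,
          show ((M - m : ℕ) : ℝ) * p ^ 2 = ∑ n ∈ Finset.range (M - m), p ^ 2 by simp,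
          ← Finset.sum_sub_distrib]
        exact Finset.sum_congr rfl fun n _ => by ring
      rw [e] at hω'
      have h4 := (abs_add_le (∑ n ∈ Finset.range (M - m), U (t + n) ω * (U (t + (n + m : ℕ)) ω - p))
        (p * ∑ n ∈ Finset.range (M - m), (U (t + n) ω - p)))
      rw [abs_mul, abs_of_nonneg hp] at h4
      nlinarith [mul_le_mul_of_nonneg_left hc2'.le hp]
    linarith [measureReal_mono (μ := P) hsub, measureReal_union_le (μ := P)
      {ω | ε ≤ |∑ n ∈ Finset.range (M - m), U (t + n) ω * (U (t + (n + m : ℕ)) ω - p)|}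
      {ω | ε ≤ |∑ n ∈ Finset.range (M - m), (U (t + n) ω - p)|}]

end

/-! ### From empirical autocorrelations to spectral estimates -/

lemma btEstimate_eq (M : ℕ) (w : ℤ → ℝ) (x : ℕ → ℝ) (f : ℝ) :
    btEstimate M w x f =
      ∑ m ∈ Finset.Ioo (-(M : ℤ)) M, ((w m * empiricalAcf M x m : ℝ) : ℂ) * expo (-m) f := by
  simp_rw [btEstimate, exp_neg_eq_expo]

lemma continuous_btEstimate (M : ℕ) (w : ℤ → ℝ) (x : ℕ → ℝ) : Continuous (btEstimate M w x) := by
  rw [funext (btEstimate_eq M w x)]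
  exact continuous_finsetSum _ fun _ _ => (continuous_expo _).const_mul _

lemma acf_neg (s : ℝ → ℝ) (m : ℤ) : acf s (-m) = (starRingEnd ℂ) (acf s m) := by
  rw [acf_eq, acf_eq, ← integral_conj]
  refine integral_congr_ae (Filter.Eventually.of_forall fun f => ?_)
  simp only [map_mul, Complex.conj_ofReal, conj_expo]

lemma noisyAcf_re_natAbs (s : ℝ → ℝ) (σ : NNReal) (m : ℤ) :
    (noisyAcf s σ m.natAbs).re = (noisyAcf s σ m).re := by
  rcases Int.natAbs_eq m with h | h
  · rw [← h]
  · nth_rw 2 [h]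
    simp only [noisyAcf_re, acf_neg, Complex.conj_re, neg_eq_zero]

lemma abs_noisyAcf_re_le {s : ℝ → ℝ} (hs : IsNormalizedPSD s) (σ : NNReal) (m : ℤ) :
    |(noisyAcf s σ m).re| ≤ 1 + (σ : ℝ) ^ 2 := by
  rw [noisyAcf_re]
  refine (abs_add_le _ _).trans (add_le_add ((Complex.abs_re_le_norm _).trans
    (norm_acf_le_one hs m)) ?_)
  split_ifs
  · rw [abs_of_nonneg (by positivity)]
  · rw [abs_zero]; positivity

lemma sq_le_samplingWeight {p : ℝ} (hp : 0 < p) (hp1 : p ≤ 1) (m : ℤ) :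
    p ^ 2 ≤ samplingWeight p m := by
  unfold samplingWeight
  split_ifs
  · nlinarith
  · rfl

/-- Uniformly small deviations of the empirical autocorrelations give a small `L¹` deviation of the
spectral estimate, by way of its `L²` norm. -/
lemma integral_norm_btEstimate_sub_le {s : ℝ → ℝ} {σ : NNReal}
    (hreal : ∀ m, acf s m = ((acf s m).re : ℂ)) {M : ℕ} (hM : 0 < M) {A : ℝ} {g : ℤ → ℝ}
    (hg : IsWindow M A g) {p : ℝ} (hp : 0 < p) (hp1 : p ≤ 1) {ε : ℝ} (hε : 0 ≤ ε) {x : ℕ → ℝ}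
    (hx : ∀ m < M, |∑ n ∈ Finset.range (M - m), x (n + m) * x n -
      (noisyAcf s σ m).re * ((M - m) * samplingWeight p m)| ≤ M * ε) :
    ∫ f in (0 : ℝ)..1, ‖btEstimate M (correctedWindow g p) x f - meanEstimate M g s σ f‖ ≤
      A * ε / p ^ 2 := by
  have hM' : (0 : ℝ) < M := by exact_mod_cast hM
  have hA := hg.one_le hM
  set S := Finset.Ioo (-(M : ℤ)) (M : ℤ)
  set a : ℤ → ℝ := fun m => correctedWindow g p m *
    (empiricalAcf M x m - samplingWeight p m * (1 - (|m| : ℤ) / (M : ℝ)) * (noisyAcf s σ m).re)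
    with ha
  have hc (m : ℤ) : noisyAcf s σ m = ((noisyAcf s σ m).re : ℂ) := by
    rw [noisyAcf_re, noisyAcf, hreal m]
    split_ifs <;> simp
  have hdiff (f : ℝ) : btEstimate M (correctedWindow g p) x f - meanEstimate M g s σ f =
      ∑ i : S, (a i : ℂ) * expo (-(i : ℤ)) f := by
    rw [btEstimate_eq, meanEstimate, ← Finset.sum_sub_distrib,
      ← sum_Ioo_eq_sum_attach S fun m => (a m : ℂ)]
    refine Finset.sum_congr rfl fun m _ => ?_
    rw [hc m, ← Complex.ofReal_mul, ← sub_mul, ← Complex.ofReal_sub]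
    congr 2
    have hu : samplingWeight p m ≠ 0 :=
      ((pow_pos hp 2).trans_le (sq_le_samplingWeight hp hp1 m)).ne'
    simp only [ha, correctedWindow]
    field_simp
  have hbound (m : ℤ) (hm : m ∈ S) : a m ^ 2 ≤ g m ^ 2 * (ε / p ^ 2) ^ 2 := by
    rw [Finset.mem_Ioo, ← abs_lt] at hm
    have hm' : m.natAbs < M := by rw [Int.abs_eq_natAbs] at hm; omega
    have hu := sq_le_samplingWeight hp hp1 m
    have hwn : samplingWeight p (m.natAbs : ℤ) = samplingWeight p m := by
      simp [samplingWeight]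
    have h1 := hx m.natAbs hm'
    rw [noisyAcf_re_natAbs, hwn] at h1
    have h2 : |empiricalAcf M x m -
        samplingWeight p m * (1 - (|m| : ℤ) / (M : ℝ)) * (noisyAcf s σ m).re| ≤ ε := by
      have e : empiricalAcf M x m -
          samplingWeight p m * (1 - (|m| : ℤ) / (M : ℝ)) * (noisyAcf s σ m).re =
          (1 / (M : ℝ)) * (∑ n ∈ Finset.range (M - m.natAbs), x (n + m.natAbs) * x n -
            (noisyAcf s σ m).re * ((M - m.natAbs) * samplingWeight p m)) := by
        have : ((|m| : ℤ) : ℝ) = (m.natAbs : ℝ) := by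
          rw [Nat.cast_natAbs]
        rw [empiricalAcf, this]
        field_simp
      rw [e, abs_mul, abs_of_pos (by positivity : (0 : ℝ) < 1 / M), one_div,
        inv_mul_le_iff₀ hM']
      exact h1
    have h3 : |a m| ≤ |g m| * (ε / p ^ 2) := by
      simp only [ha, correctedWindow]
      rw [abs_mul, abs_div, abs_of_pos ((pow_pos hp 2).trans_le hu)]
      calc |g m| / samplingWeight p m * _ ≤ |g m| / p ^ 2 * ε := by gcongr
        _ = |g m| * (ε / p ^ 2) := by ring
    calc a m ^ 2 = |a m| ^ 2 := (sq_abs _).symm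
      _ ≤ (|g m| * (ε / p ^ 2)) ^ 2 := by gcongr
      _ = g m ^ 2 * (ε / p ^ 2) ^ 2 := by rw [mul_pow, sq_abs]
  simp_rw [hdiff]
  refine (integral_norm_trigSum_le _ (injective_neg_coe S)).trans ?_
  refine Real.sqrt_le_iff.mpr ⟨by positivity, ?_⟩
  calc ∑ i : S, ‖(a i : ℂ)‖ ^ 2 = ∑ m ∈ S, a m ^ 2 := by
        rw [← Finset.sum_coe_sort S fun m => a m ^ 2]; simp
    _ ≤ ∑ m ∈ S, g m ^ 2 * (ε / p ^ 2) ^ 2 := Finset.sum_le_sum hbound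
    _ = (∑ m ∈ S, g m ^ 2) * (ε / p ^ 2) ^ 2 := by rw [Finset.sum_mul]
    _ ≤ A * (ε / p ^ 2) ^ 2 := by gcongr; exact hg.sum_sq_le hM
    _ ≤ A ^ 2 * (ε / p ^ 2) ^ 2 := by
        gcongr
        exact le_self_pow₀ hA two_ne_zero
    _ = (A * ε / p ^ 2) ^ 2 := by ring

/-! ### Comparison of the distances -/

lemma obsDist_le {M : ℕ} {w : ℤ → ℝ} {x y : ℕ → ℝ} {E : ℝ → ℂ} (hE : Continuous E) {T : ℝ}
    (hx : ∫ f in (0 : ℝ)..1, ‖btEstimate M w x f - E f‖ ≤ T)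
    (hy : ∫ f in (0 : ℝ)..1, ‖btEstimate M w y f - E f‖ ≤ T) : obsDist M w x y ≤ T := by
  have hcx := continuous_btEstimate M w x
  have hcy := continuous_btEstimate M w y
  have h : ∫ f in (0 : ℝ)..1, ‖btEstimate M w x f - btEstimate M w y f‖ ≤
      ∫ f in (0 : ℝ)..1, (‖btEstimate M w x f - E f‖ + ‖btEstimate M w y f - E f‖) := by
    refine intervalIntegral.integral_mono zero_le_one
      (Continuous.intervalIntegrable (by fun_prop) _ _)
      (Continuous.intervalIntegrable (by fun_prop) _ _) fun f => ?_
    rw [norm_sub_rev (btEstimate M w y f)]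
    exact norm_sub_le_norm_sub_add_norm_sub _ _ _
  rw [intervalIntegral.integral_add (Continuous.intervalIntegrable (by fun_prop) _ _)
    (Continuous.intervalIntegrable (by fun_prop) _ _)] at h
  rw [obsDist]
  linarith

lemma IsNormalizedPSD.setIntegral_eq_one {s : ℝ → ℝ} (hs : IsNormalizedPSD s) :
    ∫ f in Set.Ico (0 : ℝ) 1, s f = 1 := by
  rw [restrict_Ico_eq_restrict_Ioc, ← intervalIntegral.integral_of_le zero_le_one,
    hs.integral_eq_one]

lemma psdDist_eq (s s' : ℝ → ℝ) :
    psdDist s s' = (1 / 2) * ∫ f in Set.Ico (0 : ℝ) 1, |s f - s' f| := by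
  rw [psdDist, intervalIntegral.integral_of_le zero_le_one, restrict_Ico_eq_restrict_Ioc]

lemma psdDist_le_one {s s' : ℝ → ℝ} (hs : IsNormalizedPSD s) (hs' : IsNormalizedPSD s') :
    psdDist s s' ≤ 1 := by
  have h : ∫ f in Set.Ico (0 : ℝ) 1, |s f - s' f| ≤ ∫ f in Set.Ico (0 : ℝ) 1, (s f + s' f) := by
    refine setIntegral_mono_on (hs.integrableOn.sub hs'.integrableOn).abs
      (hs.integrableOn.add hs'.integrableOn) measurableSet_Ico fun f hf => ?_
    have h1 := hs.nonneg f hf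
    have h2 := hs'.nonneg f hf
    rw [abs_le]; constructor <;> linarith
  rw [integral_add hs.integrableOn hs'.integrableOn, hs.setIntegral_eq_one,
    hs'.setIntegral_eq_one] at h
  rw [psdDist_eq]
  linarith

/-- The noise floor `c` is common to both means, so that it cancels in the distance. -/
lemma psdDist_le {s s' : ℝ → ℝ} (hs : IsNormalizedPSD s) (hs' : IsNormalizedPSD s')
    {M : ℕ} {w : ℤ → ℝ} {x y : ℕ → ℝ} {E E' : ℝ → ℂ} (hE : Continuous E) (hE' : Continuous E')
    {T b c : ℝ}
    (hb : ∀ f ∈ Set.Ico (0 : ℝ) 1, ‖E f - (s f + c : ℝ)‖ ≤ b)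
    (hb' : ∀ f ∈ Set.Ico (0 : ℝ) 1, ‖E' f - (s' f + c : ℝ)‖ ≤ b)
    (hx : ∫ f in (0 : ℝ)..1, ‖btEstimate M w x f - E f‖ ≤ T)
    (hy : ∫ f in (0 : ℝ)..1, ‖btEstimate M w y f - E' f‖ ≤ T) :
    psdDist s s' ≤ obsDist M w x y + T + b := by
  have hcx := continuous_btEstimate M w x
  have hcy := continuous_btEstimate M w y
  rw [obsDist]
  rw [intervalIntegral.integral_of_le zero_le_one, ← restrict_Ico_eq_restrict_Ioc] at hx hy ⊢
  rw [psdDist_eq]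
  have hi {F : ℝ → ℝ} (hF : Continuous F) : IntegrableOn F (Set.Ico 0 1) :=
    hF.integrableOn_Icc.mono_set Set.Ico_subset_Icc_self
  have h : ∫ f in Set.Ico (0 : ℝ) 1, |s f - s' f| ≤
      ∫ f in Set.Ico (0 : ℝ) 1, (‖btEstimate M w x f - btEstimate M w y f‖ +
        ‖btEstimate M w x f - E f‖ + ‖btEstimate M w y f - E' f‖ + 2 * b) := by
    refine setIntegral_mono_on (hs.integrableOn.sub hs'.integrableOn).abs
      (hi (by fun_prop)) measurableSet_Ico fun f hf => ?_
    have e : ((s f - s' f : ℝ) : ℂ) = (btEstimate M w x f - btEstimate M w y f) -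
        (btEstimate M w x f - E f) + (btEstimate M w y f - E' f) - (E f - (s f + c : ℝ)) +
        (E' f - (s' f + c : ℝ)) := by
      push_cast; ring
    rw [← Real.norm_eq_abs, ← Complex.norm_real, e]
    refine (norm_add_le _ _).trans ?_
    refine (add_le_add ((norm_sub_le _ _).trans (add_le_add ((norm_add_le _ _).trans
      (add_le_add (norm_sub_le _ _) le_rfl)) (hb f hf))) (hb' f hf)).trans ?_
    linarith
  rw [integral_add (hi (by fun_prop)) (hi (by fun_prop)),
    integral_add (hi (by fun_prop)) (hi (by fun_prop)),
    integral_add (hi (by fun_prop)) (hi (by fun_prop))] at h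
  simp only [integral_const, MeasurableSet.univ, measureReal_restrict_apply, Set.univ_inter,
    Real.volume_real_Ico, sub_zero, zero_le_one, sup_of_le_left, smul_eq_mul, one_mul] at h
  linarith

lemma acfMoment_le_max {L : ℕ} (M : ℕ) (g : ℤ → ℝ) (s : Fin L → ℝ → ℝ) (l : Fin L) :
    acfMoment M g (s l) ≤ maxAcfMoment M g s :=
  le_ciSup (f := fun l => acfMoment M g (s l)) (Set.finite_range _).bddAbove l

lemma acfMoment_nonneg (M : ℕ) (g : ℤ → ℝ) (s : ℝ → ℝ) : 0 ≤ acfMoment M g s :=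
  tsum_nonneg fun _ => mul_nonneg (abs_nonneg _) (norm_nonneg _)

lemma one_le_psdBound {L : ℕ} {s : Fin L → ℝ → ℝ} (hs : ∀ l, IsNormalizedPSD (s l))
    (l : Fin L) : 1 ≤ psdBound s := by
  calc (1 : ℝ) = ∫ f in Set.Ico (0 : ℝ) 1, s l f := (hs l).setIntegral_eq_one.symm
    _ ≤ ∫ _ in Set.Ico (0 : ℝ) 1, psdBound s :=
      setIntegral_mono_on (hs l).integrableOn (by simp) measurableSet_Ico
        fun f hf => le_psdBound hs l hf
    _ = psdBound s := by simp

/-! ### Deviation of a single empirical autocorrelation -/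

lemma exp_neg_four_mul_log {M : ℕ} (hM : 0 < M) :
    Real.exp (-(4 * Real.log M)) = 1 / (M : ℝ) ^ 4 := by
  have hM' : (0 : ℝ) < M := by exact_mod_cast hM
  rw [Real.exp_neg, show 4 * Real.log M = (4 : ℕ) * Real.log M by norm_num, Real.exp_nat_mul,
    Real.exp_log hM', one_div]

/-- Deviation bound for the lag-`m` products of one observation: the Gaussian part contributes
`4√2 (B + σ²)` and the sampling part `√2 (1 + p) (1 + σ²)`, in units of `√(M log M)`. -/
lemma IsRealization.measure_lag_deviation_le {Ω : Type*} [MeasurableSpace Ω] {P : Measure Ω}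
    [IsProbabilityMeasure P] {p : ℝ} {σ : NNReal} {s : ℝ → ℝ} {U X W : ℤ → Ω → ℝ}
    (h : IsRealization P p σ s U X W) (hs : IsNormalizedPSD s) (hp : 0 ≤ p) {B : ℝ}
    (hB : ∀ f ∈ Set.Ico (0 : ℝ) 1, s f ≤ B) (hBσ : 0 < B + (σ : ℝ) ^ 2) (t : ℤ) {M m : ℕ}
    (hm : m < M) (hlog : √(Real.log M / M) ≤ 1 / 16) :
    P.real {ω | ¬ |∑ n ∈ Finset.range (M - m),
        observation U X W t ω (n + m) * observation U X W t ω n -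
        (noisyAcf s σ m).re * ((M - m) * samplingWeight p m)| ≤
        M * ((4 * √2 * (B + (σ : ℝ) ^ 2) + √2 * (1 + p) * (1 + (σ : ℝ) ^ 2)) *
          √(Real.log M / M))} ≤ 6 / (M : ℝ) ^ 4 := by
  have hM : 0 < M := (Nat.zero_le m).trans_lt hm
  have hM' : (0 : ℝ) < M := by exact_mod_cast hM
  have hM1 : (1 : ℝ) ≤ M := by exact_mod_cast hM
  set b : ℝ := B + (σ : ℝ) ^ 2
  set r := √(Real.log M / M) with hr
  have hr0 : 0 ≤ r := Real.sqrt_nonneg _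
  have hr2 : M * r ^ 2 = Real.log M := by
    rw [hr, Real.sq_sqrt (div_nonneg (Real.log_nonneg hM1) hM'.le)]
    field_simp
  have h2 : √2 ^ 2 = (2 : ℝ) := Real.sq_sqrt zero_le_two
  have h2' : √2 ≤ (2 : ℝ) := by nlinarith [Real.sqrt_nonneg 2]
  have hδ' : 4 * √2 * b * (M * r) ≤ b * M / 2 := by
    have : 4 * √2 * r ≤ 1 / 2 := by nlinarith [Real.sqrt_nonneg 2]
    calc 4 * √2 * b * (M * r) = b * M * (4 * √2 * r) := by ring
      _ ≤ b * M * (1 / 2) := by gcongr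
      _ = b * M / 2 := by ring
  have hG := h.measure_lag_sum_sub_ge_le hs hB hBσ t M m (δ := 4 * √2 * b * (M * r))
    (by positivity) hδ'
  have hS := h.sampling.measure_lag_sum_sub_ge_le hp t hm (ε := √2 * (M * r)) (by positivity)
  have eG : -(4 * √2 * b * (M * r)) ^ 2 / (8 * b ^ 2 * M) = -(4 * Real.log M) := by
    rw [← hr2, mul_pow, mul_pow, mul_pow, h2]
    field_simp
    ring
  have eS : -2 * (√2 * (M * r)) ^ 2 / M = -(4 * Real.log M) := by
    rw [← hr2, mul_pow, h2]
    field_simp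
    ring
  rw [eG, exp_neg_four_mul_log hM] at hG
  rw [eS, exp_neg_four_mul_log hM] at hS
  refine (measureReal_mono (fun ω hω => ?_) (measure_ne_top _ _)).trans
    ((measureReal_union_le _ _).trans ((add_le_add hG hS).trans_eq (by ring)))
  by_contra hcon
  obtain ⟨hc1, hc2⟩ := not_or.mp hcon
  refine hω ?_
  set Q := ∑ n ∈ Finset.range (M - m),
    observation U X W t ω (n + m) * observation U X W t ω n with hQ
  set N := ∑ n ∈ Finset.range (M - m), U (t + n) ω * U (t + (n + m : ℕ)) ω with hN
  have hc1' : |Q - (noisyAcf s σ m).re * N| < 4 * √2 * b * (M * r) := not_le.mp hc1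
  have hc2' : |N - (M - m) * samplingWeight p m| < (1 + p) * (√2 * (M * r)) := not_le.mp hc2
  have hc := abs_noisyAcf_re_le hs σ m
  calc |Q - (noisyAcf s σ m).re * ((M - m) * samplingWeight p m)|
      = |(Q - (noisyAcf s σ m).re * N) +
          (noisyAcf s σ m).re * (N - (M - m) * samplingWeight p m)| := by ring_nf
    _ ≤ |Q - (noisyAcf s σ m).re * N| +
          |(noisyAcf s σ m).re| * |N - (M - m) * samplingWeight p m| := by
        rw [← abs_mul]; exact abs_add_le _ _
    _ ≤ 4 * √2 * b * (M * r) + (1 + (σ : ℝ) ^ 2) * ((1 + p) * (√2 * (M * r))) := by gcongr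
    _ = _ := by ring

end ProcessClustering

theorem theorem3 {Ω : Type*} [MeasurableSpace Ω] (P : Measure Ω) [IsProbabilityMeasure P]
    -- `L` generative models with PSDs `s l`, and `n l` observations of the `l`-th one
    (L : ℕ) (n : Fin L → ℕ)
    (s : Fin L → ℝ → ℝ) (hs : ∀ l, ProcessClustering.IsNormalizedPSD (s l))
    -- sampling probability, noise standard deviation, observation length, window
    (p : ℝ) (hp : 0 < p) (hp1 : p ≤ 1) (σ : NNReal) (M : ℕ) (hM : 0 < M)
    (A : ℝ) (g : ℤ → ℝ) (hg : ProcessClustering.IsWindow M A g)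
    -- the `i`-th observation of the `l`-th model is a segment of a realization of that model;
    -- the joint law of the different realizations is arbitrary (they may also coincide)
    (U X W : (l : Fin L) → Fin (n l) → ℤ → Ω → ℝ) (t : (l : Fin L) → Fin (n l) → ℤ)
    (hreal : ∀ l i, ProcessClustering.IsRealization P p σ (s l) (U l i) (X l i) (W l i))
    (x : (l : Fin L) → Fin (n l) → Ω → ℕ → ℝ)
    (hx : ∀ l i, x l i = ProcessClustering.observation (U l i) (X l i) (W l i) (t l i))
    -- the clustering condition
    (hcond : ∀ k l : Fin L, k ≠ l →
      8 * √2 * A * (ProcessClustering.psdBound s + (σ : ℝ) ^ 2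
            + √2 * (1 + p) * (1 + (σ : ℝ) ^ 2)) / p ^ 2
          * √(Real.log M / M)
        + 2 * ProcessClustering.maxAcfMoment M g s
      < ProcessClustering.psdDist (s k) (s l)) :
    1 - 6 * ((∑ l, n l : ℕ) : ℝ) / (M : ℝ) ^ 2 ≤
      P.real {ω | ∀ (k l : Fin L), k ≠ l → ∀ (j : Fin (n k)) (i : Fin (n l)),
        ∀ (l' : Fin L) (i' j' : Fin (n l')), i' ≠ j' →
          ProcessClustering.obsDist M (ProcessClustering.correctedWindow g p)
              (x l' i' ω) (x l' j' ω)
            < ProcessClustering.obsDist M (ProcessClustering.correctedWindow g p)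
              (x k j ω) (x l i ω)} := by
  by_cases hkl : ∃ k l : Fin L, k ≠ l
  swap
  · -- With at most one model there is no pair to compare, and the event is the whole space.
    push Not at hkl
    have huniv : {ω | ∀ (k l : Fin L), k ≠ l → ∀ (j : Fin (n k)) (i : Fin (n l)),
        ∀ (l' : Fin L) (i' j' : Fin (n l')), i' ≠ j' →
          ProcessClustering.obsDist M (ProcessClustering.correctedWindow g p)
              (x l' i' ω) (x l' j' ω)
            < ProcessClustering.obsDist M (ProcessClustering.correctedWindow g p)
              (x k j ω) (x l i ω)} = Set.univ :=
      Set.eq_univ_of_forall fun ω k l hne => absurd (hkl k l) hne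
    rw [huniv, probReal_univ, sub_le_self_iff]
    positivity
  obtain ⟨k₀, l₀, hne₀⟩ := hkl
  have hM' : (0 : ℝ) < M := by exact_mod_cast hM
  have hM1 : (1 : ℝ) ≤ M := by exact_mod_cast hM
  have hA := hg.one_le hM
  have hB1 := ProcessClustering.one_le_psdBound hs k₀
  set B := ProcessClustering.psdBound s
  set μ := ProcessClustering.maxAcfMoment M g s
  set r := √(Real.log M / M)
  have hr0 : 0 ≤ r := Real.sqrt_nonneg _
  have hμ : 0 ≤ μ := (ProcessClustering.acfMoment_nonneg M g (s k₀)).trans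
    (ProcessClustering.acfMoment_le_max M g s k₀)
  have h2 : √2 ^ 2 = (2 : ℝ) := Real.sq_sqrt zero_le_two
  set C := B + (σ : ℝ) ^ 2 + √2 * (1 + p) * (1 + (σ : ℝ) ^ 2) with hC
  have hCge : √2 ≤ C := by
    have : √2 * 1 * 1 ≤ √2 * (1 + p) * (1 + (σ : ℝ) ^ 2) := by
      gcongr
      · linarith
      · linarith [sq_nonneg (σ : ℝ)]
    linarith [sq_nonneg (σ : ℝ)]
  set T := 4 * √2 * A * C / p ^ 2 * r with hT
  have hcond' : ∀ k l : Fin L, k ≠ l → 2 * T + 2 * μ < ProcessClustering.psdDist (s k) (s l) := by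
    intro k l hne
    refine lt_of_eq_of_lt ?_ (hcond k l hne)
    rw [hT]; ring
  -- The distance of two models is at most `1`, so the clustering condition forces `M` to be large.
  have hr16 : r ≤ 1 / 16 := by
    have h1 := (hcond' k₀ l₀ hne₀).trans_le
      (ProcessClustering.psdDist_le_one (hs k₀) (hs l₀))
    have h3 : 4 * √2 * 1 * √2 / 1 * r ≤ T := by
      rw [hT]
      gcongr
      exact pow_le_one₀ hp.le hp1
    have h4 : 4 * √2 * 1 * √2 / 1 * r = 8 * r := by linear_combination 4 * r * h2
    linarith
  set κ := 4 * √2 * (B + (σ : ℝ) ^ 2) + √2 * (1 + p) * (1 + (σ : ℝ) ^ 2) with hκ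
  have hκ0 : 0 ≤ κ := by positivity
  have hκT : A * (κ * r) / p ^ 2 ≤ T := by
    have h1 : κ ≤ 4 * √2 * C := by
      have h3 : 0 ≤ √2 * (1 + p) * (1 + (σ : ℝ) ^ 2) := by positivity
      have h4 : 1 ≤ 4 * √2 := by nlinarith [Real.sqrt_nonneg 2]
      rw [hκ, hC]
      nlinarith
    calc A * (κ * r) / p ^ 2 ≤ A * (4 * √2 * C * r) / p ^ 2 := by gcongr
      _ = T := by rw [hT]; ring
  let bad : ((l : Fin L) × Fin (n l)) × Fin M → Set Ω := fun q =>
    {ω | ¬ |∑ j ∈ Finset.range (M - q.2), x q.1.1 q.1.2 ω (j + q.2) * x q.1.1 q.1.2 ω j -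
      (ProcessClustering.noisyAcf (s q.1.1) σ (q.2 : ℕ)).re *
        ((M - (q.2 : ℕ)) * ProcessClustering.samplingWeight p (q.2 : ℕ))| ≤ M * (κ * r)}
  have hbad (q) : P.real (bad q) ≤ 6 / (M : ℝ) ^ 4 := by
    obtain ⟨⟨l, i⟩, m⟩ := q
    simp only [bad, hx]
    exact (hreal l i).measure_lag_deviation_le (hs l) hp.le
      (fun f hf => ProcessClustering.le_psdBound hs l hf) (by positivity) (t l i) m.2 hr16
  have hunion : P.real (⋃ q, bad q) ≤ 6 * ((∑ l, n l : ℕ) : ℝ) / (M : ℝ) ^ 2 := by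
    calc P.real (⋃ q, bad q) ≤ ∑ q, P.real (bad q) := measureReal_iUnion_fintype_le _
      _ ≤ ∑ _q : ((l : Fin L) × Fin (n l)) × Fin M, 6 / (M : ℝ) ^ 4 :=
        Finset.sum_le_sum fun q _ => hbad q
      _ = 6 * ((∑ l, n l : ℕ) : ℝ) / (M : ℝ) ^ 3 := by
        rw [Finset.sum_const, Finset.card_univ, Fintype.card_prod, Fintype.card_sigma]
        simp only [Fintype.card_fin, nsmul_eq_mul, Nat.cast_mul]
        field_simp
      _ ≤ 6 * ((∑ l, n l : ℕ) : ℝ) / (M : ℝ) ^ 2 := by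
        gcongr 6 * _ / ?_
        exact pow_le_pow_right₀ hM1 (by norm_num)
  have hcompl : 1 - P.real (⋃ q, bad q) ≤ P.real (⋃ q, bad q)ᶜ := by
    have h1 := measureReal_union_le (μ := P) (⋃ q, bad q) (⋃ q, bad q)ᶜ
    rw [Set.union_compl_self, probReal_univ] at h1
    linarith
  refine (sub_le_sub_left hunion 1).trans (hcompl.trans (measureReal_mono ?_ (measure_ne_top _ _)))
  intro ω hω k l hne j i l' i' j' _
  -- Outside the union, every spectral estimate is within `T` of its mean.
  have hest (l : Fin L) (i : Fin (n l)) : ∫ f in (0 : ℝ)..1,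
      ‖ProcessClustering.btEstimate M (ProcessClustering.correctedWindow g p) (x l i ω) f -
        ProcessClustering.meanEstimate M g (s l) σ f‖ ≤ T := by
    refine (ProcessClustering.integral_norm_btEstimate_sub_le (σ := σ)
      (hreal l i).signal.acf_eq_re hM hg hp hp1 (mul_nonneg hκ0 hr0) fun m hm => ?_).trans hκT
    by_contra hcon
    exact hω (Set.mem_iUnion.mpr ⟨⟨⟨l, i⟩, ⟨m, hm⟩⟩, hcon⟩)
  have hbias (l : Fin L) (f : ℝ) (hf : f ∈ Set.Ico (0 : ℝ) 1) :
      ‖ProcessClustering.meanEstimate M g (s l) σ f - (s l f + (σ : ℝ) ^ 2 : ℝ)‖ ≤ μ :=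
    (ProcessClustering.norm_meanEstimate_sub_le (hs l) hM hg σ hf).trans
      (ProcessClustering.acfMoment_le_max M g s l)
  have hsame := ProcessClustering.obsDist_le
    (ProcessClustering.continuous_meanEstimate M g (s l') σ) (hest l' i') (hest l' j')
  have hdiff := ProcessClustering.psdDist_le (hs k) (hs l)
    (ProcessClustering.continuous_meanEstimate M g (s k) σ)
    (ProcessClustering.continuous_meanEstimate M g (s l) σ) (hbias k) (hbias l)
    (hest k j) (hest l i)
  linarith [hcond' k l hne]
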